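/- **Elephant random walks.** Let $0<p<1$, and for each $k\ge 1$ let $\mathcal M_k\subseteq\{1,\dots,k\}$ be a nonempty set (the memory after $k$ steps). The elephant random walk with parameter $p$ and memories $(\mathcal M_k)$ has steps $X_1,X_2,\ldots\in\{-1,+1\}$ with $P(X_1=1)=p=1-P(X_1=-1)$; for $k\ge1$, given $X_1,\dots,X_k$, one has $X_{k+1}=X_K$ with probability $p$ and $X_{k+1}=-X_K$ with probability $1-p$, where $K$ is uniformly distributed on $\mathcal M_k$. Full memory means $\mathcal M_k=\{1,\dots,k\}$. **Theorem.** Let $0<p<1$ and let $(m_n)$ be nonnegative integers with $m_n\to\infty$ and $m_n/n\to0$ as $n\to\infty$. For each $n$ let $X_{n,1},X_{n,2},\dots$ be the steps of an elephant random walk with parameter $p$ in which the elephant remembers the first $m_n$ steps and the most recent one, that is, with memories $\mathcal M_k=\{1,\dots,\min(m_n,k)\}\cup\{k\}$, $k\ge1$ (the walks for different $n$ may live on different probability spaces). Put $S_n=\sum_{k=1}^nX_{n,k}$ and $m=m_n$. As $n\to\infty$: (a) if $0<p<3/4$, then $\dfrac{S_n\sqrt m}{n}\to \mathcal N\!\left(0,\dfrac{(2p-1)^2}{3-4p}\right)$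 in distribution (for $p=1/2$ the limit is the point mass at $0$); (b) if $p=3/4$, then $\dfrac{S_n\sqrt{m/\log m}}{n}\to\mathcal N\!\left(0,\tfrac14\right)$ in distribution; (c) if $3/4<p<1$, then $\dfrac{S_n\,m^{2(1-p)}}{n}\to(2p-1)\,L$ in distribution, where $L$ is the almost sure limit (which exists) of $W_k/k^{2p-1}$ as $k\to\infty$, and $W_k$ is the position after $k$ steps of the elephant random walk with full memory and parameter $p$. -/

import Mathlib

open MeasureTheory ProbabilityTheory Filter Topology

/-- The elephant remembers the steps with indices in the nonempty finite set `A`; the steps taken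
so far are `x 1, x 2, …`. She chooses `K` uniformly in `A`, and her next step is `x K` with
probability `p` and `-x K` with probability `1 - p`. This is the probability that the next step
equals `a`. -/
noncomputable def nextStepProb (p : ℝ) (A : Finset ℕ) (x : ℕ → ℝ) (a : ℝ) : ℝ :=
  ∑ i ∈ A, (1 / (A.card : ℝ)) *
    ((if a = x i then p else 0) + (if a = -x i then 1 - p else 0))

/-- `X 1, X 2, …` are the steps of an elephant random walk with parameter `p` (the value `X 0` is
not used) in which the step number `k + 1` is based on the steps with indices in the memory `M k`:
the steps are `±1`, the first step is `1` with probability `p`, and, given that the first `k`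
steps are `x 1, …, x k`, the step number `k + 1` equals `x (k + 1)` with probability
`nextStepProb p (M k) x (x (k + 1))`. -/
structure IsElephantWalk {Ω : Type*} [MeasurableSpace Ω] (P : Measure Ω) (p : ℝ)
    (M : ℕ → Finset ℕ) (X : ℕ → Ω → ℝ) : Prop where
  measurable : ∀ k, 1 ≤ k → Measurable (X k)
  sign : ∀ k, 1 ≤ k → ∀ᵐ ω ∂P, X k ω = 1 ∨ X k ω = -1
  first : P.real {ω | X 1 ω = 1} = p
  step : ∀ k, 1 ≤ k → ∀ x : ℕ → ℝ, (∀ i, x i = 1 ∨ x i = -1) →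
    P.real {ω | ∀ i ∈ Finset.Icc 1 (k + 1), X i ω = x i} =
      P.real {ω | ∀ i ∈ Finset.Icc 1 k, X i ω = x i} * nextStepProb p (M k) x (x (k + 1))

/-- The full memory `{1, …, k}`. -/
def fullMemory (k : ℕ) : Finset ℕ := Finset.Icc 1 k

/-- The memory after `k` steps that consists of the first `m` steps (of all `k` steps as long as
`k ≤ m`) and of the most recent step: `{1, …, m, k}`. -/
def firstAndLastMemory (m k : ℕ) : Finset ℕ := Finset.Icc 1 (min m k) ∪ {k}

/-- The position `X 1 + ⋯ + X n` after `n` steps. -/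
def position {Ω : Type*} (X : ℕ → Ω → ℝ) (n : ℕ) (ω : Ω) : ℝ := ∑ k ∈ Finset.Icc 1 n, X k ω

lemma nextStepProb_nonneg {p : ℝ} (h0 : 0 ≤ p) (h1 : p ≤ 1) (A : Finset ℕ) (x : ℕ → ℝ) (a : ℝ) :
    0 ≤ nextStepProb p A x a := by
  unfold nextStepProb
  refine Finset.sum_nonneg fun i _ => mul_nonneg (by positivity) (add_nonneg ?_ ?_) <;>
    split_ifs <;> linarith

lemma nextStepProb_add {p : ℝ} {A : Finset ℕ} (hA : A.Nonempty) {x : ℕ → ℝ}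
    (hx : ∀ i ∈ A, x i = 1 ∨ x i = -1) :
    nextStepProb p A x 1 + nextStepProb p A x (-1) = 1 := by
  unfold nextStepProb
  rw [← Finset.sum_add_distrib]
  have hc : (A.card : ℝ) ≠ 0 := by exact_mod_cast hA.card_pos.ne'
  calc _ = ∑ i ∈ A, (1 / (A.card : ℝ)) := Finset.sum_congr rfl fun i hi => by
        rcases hx i hi with h | h <;> rw [h] <;> norm_num <;> ring
    _ = 1 := by simp [hc]

lemma nextStepProb_congr {p : ℝ} {A : Finset ℕ} {x y : ℕ → ℝ} (h : ∀ i ∈ A, x i = y i) (a : ℝ) :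
    nextStepProb p A x a = nextStepProb p A y a :=
  Finset.sum_congr rfl fun i hi => by rw [h i hi]

/-- The probability that the step number `n + 1` is `1`, given the first `n` steps `x`. -/
noncomputable def upProb (p : ℝ) (M : ℕ → Finset ℕ) (n : ℕ) (x : ℕ → ℝ) : ℝ :=
  if n = 0 then p else nextStepProb p (M n) x 1

/-- The first `n` steps of an elephant random walk that is driven by independent uniform
variables `u 1, u 2, …`. -/
noncomputable def drivenSteps (p : ℝ) (M : ℕ → Finset ℕ) (u : ℕ → ℝ) : ℕ → ℕ → ℝ
  | 0 => fun _ => 1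
  | n + 1 => Function.update (drivenSteps p M u n) (n + 1)
      (if u (n + 1) ≤ upProb p M n (drivenSteps p M u n) then 1 else -1)

lemma drivenSteps_eq (p : ℝ) (M : ℕ → Finset ℕ) (u : ℕ → ℝ) {n i : ℕ} (h : i ≤ n) :
    drivenSteps p M u n i = drivenSteps p M u i i := by
  induction n, h using Nat.le_induction with
  | base => rfl
  | succ n hn ih =>
    rw [drivenSteps, Function.update_of_ne (by omega), ih]

/-- Elephant random walks exist, for all memories and all parameters. -/
theorem exists_isElephantWalk {p : ℝ} (h0 : 0 ≤ p) (h1 : p ≤ 1) (M : ℕ → Finset ℕ)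
    (hM : ∀ k, 1 ≤ k → (M k).Nonempty ∧ M k ⊆ Finset.Icc 1 k) :
    ∃ (P : Measure (ℕ → ℝ)) (X : ℕ → (ℕ → ℝ) → ℝ),
      IsProbabilityMeasure P ∧ IsElephantWalk P p M X := by
  have hU : IsProbabilityMeasure (volume.restrict (Set.Icc (0 : ℝ) 1)) := ⟨by simp⟩
  have hval : ∀ u k, drivenSteps p M u k k = 1 ∨ drivenSteps p M u k k = -1 := by
    intro u k
    cases k with
    | zero => left; rfl
    | succ k =>
      simp only [drivenSteps, Function.update_self]
      split_ifs <;> simp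
  -- the box of driving variables that produces the path `x`
  have hbox : ∀ (x : ℕ → ℝ), (∀ i, x i = 1 ∨ x i = -1) → ∀ n,
      {u : ℕ → ℝ | ∀ i ∈ Finset.Icc 1 n, drivenSteps p M u i i = x i} =
      Set.pi (Finset.Icc 1 n : Finset ℕ) (fun i => if x i = 1 then Set.Iic (upProb p M (i - 1) x)
        else Set.Ioi (upProb p M (i - 1) x)) := by
    intro x hx n
    have hup : ∀ u n, (∀ i ∈ Finset.Icc 1 n, drivenSteps p M u i i = x i) →
        upProb p M n (drivenSteps p M u n) = upProb p M n x := by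
      intro u n h
      unfold upProb
      split_ifs with hn
      · rfl
      · refine nextStepProb_congr (fun i hi => ?_) 1
        have hi' := (hM n (by omega)).2 hi
        rw [drivenSteps_eq p M u (Finset.mem_Icc.1 hi').2, h i hi']
    induction n with
    | zero => ext u; simp
    | succ n ih =>
      ext u
      have ihu := Set.ext_iff.1 ih u
      simp only [Set.mem_ofPred_eq, Set.mem_pi, Finset.mem_coe] at ihu
      simp only [Set.mem_ofPred_eq, Set.mem_pi, Finset.mem_coe,
        ← Finset.insert_Icc_right_eq_Icc_add_one (show 1 ≤ n + 1 by omega),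
        Finset.forall_mem_insert, ← ihu]
      refine and_congr_left fun h => ?_
      simp only [drivenSteps, Function.update_self, hup u n h, Nat.add_sub_cancel]
      rcases hx (n + 1) with e | e <;> rw [e] <;> split_ifs <;> norm_num at * <;> assumption
  have hmeas : ∀ n i, Measurable (fun u : ℕ → ℝ => drivenSteps p M u n i) := by
    intro n
    induction n with
    | zero => intro i; exact measurable_const
    | succ n ih =>
      intro i
      by_cases hi : i = n + 1
      · subst hi
        simp only [drivenSteps, Function.update_self]
        refine Measurable.ite (measurableSet_le (measurable_pi_apply _) ?_)
          measurable_const measurable_const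
        unfold upProb
        split_ifs
        · exact measurable_const
        · unfold nextStepProb
          refine Finset.measurable_sum _ fun j _ => measurable_const.mul (Measurable.add ?_ ?_)
          · exact Measurable.ite (measurableSet_eq_fun measurable_const (ih j))
              measurable_const measurable_const
          · exact Measurable.ite (measurableSet_eq_fun measurable_const (ih j).neg)
              measurable_const measurable_const
      · simpa only [drivenSteps, Function.update_of_ne hi] using ih i
  have hup01 : ∀ x : ℕ → ℝ, (∀ i, x i = 1 ∨ x i = -1) → ∀ n,
      0 ≤ upProb p M n x ∧ upProb p M n x ≤ 1 := by
    intro x hx n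
    unfold upProb
    split_ifs with hn
    · exact ⟨h0, h1⟩
    · have := nextStepProb_add (p := p) (hM n (by omega)).1 (x := x) fun i _ => hx i
      have := nextStepProb_nonneg h0 h1 (M n) x (-1)
      exact ⟨nextStepProb_nonneg h0 h1 _ _ _, by linarith⟩
  have hIic : ∀ c : ℝ, 0 ≤ c → c ≤ 1 →
      (volume.restrict (Set.Icc (0 : ℝ) 1)).real (Set.Iic c) = c := by
    intro c hc hc'
    rw [measureReal_restrict_apply measurableSet_Iic]
    have : Set.Iic c ∩ Set.Icc 0 1 = Set.Icc 0 c := by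
      ext t; simp only [Set.mem_inter_iff, Set.mem_Iic, Set.mem_Icc]
      constructor
      · rintro ⟨a, b, _⟩; exact ⟨b, a⟩
      · rintro ⟨a, b⟩; exact ⟨b, a, b.trans hc'⟩
    rw [this]; simp [hc]
  have hIoi : ∀ c : ℝ, 0 ≤ c → c ≤ 1 →
      (volume.restrict (Set.Icc (0 : ℝ) 1)).real (Set.Ioi c) = 1 - c := by
    intro c hc hc'
    rw [← Set.compl_Iic, probReal_compl_eq_one_sub measurableSet_Iic, hIic c hc hc']
  have hprod : ∀ x : ℕ → ℝ, (∀ i, x i = 1 ∨ x i = -1) → ∀ n,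
      (Measure.infinitePi fun _ : ℕ => volume.restrict (Set.Icc (0 : ℝ) 1)).real
        {u : ℕ → ℝ | ∀ i ∈ Finset.Icc 1 n, drivenSteps p M u i i = x i} =
      ∏ i ∈ Finset.Icc 1 n, if x i = 1 then upProb p M (i - 1) x
        else 1 - upProb p M (i - 1) x := by
    intro x hx n
    rw [hbox x hx n, Measure.real, Measure.infinitePi_pi, ENNReal.toReal_prod]
    · refine Finset.prod_congr rfl fun i _ => ?_
      obtain ⟨a, b⟩ := hup01 x hx (i - 1)
      split_ifs
      · exact hIic _ a b
      · exact hIoi _ a b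
    · intro i _
      split_ifs
      · exact measurableSet_Iic
      · exact measurableSet_Ioi
  refine ⟨Measure.infinitePi fun _ => volume.restrict (Set.Icc (0 : ℝ) 1),
    fun k u => drivenSteps p M u k k, inferInstance, fun k _ => hmeas k k,
    fun k _ => Eventually.of_forall fun u => hval u k, ?_, ?_⟩
  · have := hprod (fun _ => 1) (fun _ => Or.inl rfl) 1
    simpa [upProb] using this
  · intro k hk x hx
    rw [hprod x hx, hprod x hx, Finset.prod_Icc_succ_top (by omega)]
    congr 1
    have hk' : upProb p M k x = nextStepProb p (M k) x 1 := by
      unfold upProb; rw [if_neg (by omega)]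
    simp only [Nat.add_sub_cancel, hk']
    rcases hx (k + 1) with e | e <;> rw [e]
    · simp
    · have := nextStepProb_add (p := p) (hM k hk).1 (x := x) fun i _ => hx i
      norm_num
      linarith

/-! Write a = 2p - 1, S_k for the position after k steps and m for m_n. The walk has two phases.
After time m the conditional mean of the next step is a(X_k + S_m)/(m + 1). The steps therefore
fluctuate about the fixed point μ = a S_m/(m + 1 - a) of this map, and their correlations are damped
by the factor a/(m + 1). Hence S_n - S_m - (n - m)μ has second moment O(n)
(`integral_remainder_sq_le`). In all three cases the normalization is b/n with b² ≤ m eventually,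
and since m/n → 0 this remainder disappears: b S_n/n behaves like a · b S_m/m
(`tendstoInDistribution_position`). Only the first m steps matter, and they form a walk with full
memory. For full memory, E[S_{k+1} | past] = (1 + a/k) S_k, so c_k S_k is a martingale for the
weights c_k ~ Γ(1 + a) k^{-a}. The three regimes come from V_n = ∑_{k ≤ n} c_k²: it is asymptotic to
n c_n²/(1 - 2a) if a < 1/2, to n c_n² log n if a = 1/2, and bounded if a > 1/2. In the first two
regimes a one-step recursion for characteristic functions gives a central limit theorem with
explicit error (`norm_integral_exp_sub_le`), which applies to walks on varying probability spaces.
In the third the martingale is bounded in L², hence converges almost surely. The first m steps have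
the same law as those of the fixed walk W (`integral_eq_integral`), so dominated convergence along W
gives the limit of the characteristic functions. -/

/-! ### Expectations as finite sums over sign paths -/

/-- The path of signs which are `1` exactly on `A`. -/
def signPath (A : Finset ℕ) (i : ℕ) : ℝ := if i ∈ A then 1 else -1

lemma signPath_sign (A : Finset ℕ) (i : ℕ) : signPath A i = 1 ∨ signPath A i = -1 := by
  unfold signPath; split_ifs <;> simp

lemma signPath_insert_of_ne {A : Finset ℕ} {i j : ℕ} (h : i ≠ j) :
    signPath (insert j A) i = signPath A i := by
  simp [signPath, h]

/-- The event that the first `k` steps are those of `x`. -/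
def pathEvent {Ω : Type*} (X : ℕ → Ω → ℝ) (k : ℕ) (x : ℕ → ℝ) : Set Ω :=
  {ω | ∀ i ∈ Finset.Icc 1 k, X i ω = x i}

lemma pathEvent_congr {Ω : Type*} (X : ℕ → Ω → ℝ) {k : ℕ} {x y : ℕ → ℝ}
    (h : ∀ i ∈ Finset.Icc 1 k, x i = y i) : pathEvent X k x = pathEvent X k y := by
  ext ω
  exact forall₂_congr fun i hi => by rw [h i hi]

/-- This difference is the conditional mean of the next step: a remembered sign is copied with
probability p and flipped with probability 1 - p, so it contributes 2p - 1 times itself. -/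
lemma nextStepProb_one_sub_neg_one {p : ℝ} {A : Finset ℕ} {x : ℕ → ℝ}
    (hx : ∀ i ∈ A, x i = 1 ∨ x i = -1) :
    nextStepProb p A x 1 - nextStepProb p A x (-1) = (2 * p - 1) * ((∑ i ∈ A, x i) / A.card) := by
  unfold nextStepProb
  rw [← Finset.sum_sub_distrib, Finset.sum_div, Finset.mul_sum]
  refine Finset.sum_congr rfl fun i hi => ?_
  rcases hx i hi with h | h <;> rw [h] <;> norm_num <;> ring

namespace IsElephantWalk

variable {Ω : Type*} [MeasurableSpace Ω] {P : Measure Ω} {p : ℝ} {M : ℕ → Finset ℕ}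
  {X : ℕ → Ω → ℝ}

lemma measurableSet_pathEvent (hX : IsElephantWalk P p M X) (k : ℕ) (x : ℕ → ℝ) :
    MeasurableSet (pathEvent X k x) := by
  have : pathEvent X k x = ⋂ i ∈ Finset.Icc 1 k, X i ⁻¹' {x i} := by
    ext ω; simp [pathEvent]
  rw [this]
  exact Finset.measurableSet_biInter _ fun i hi =>
    hX.measurable i (Finset.mem_Icc.1 hi).1 (measurableSet_singleton _)

lemma ae_sign (hX : IsElephantWalk P p M X) :
    ∀ᵐ ω ∂P, ∀ k, 1 ≤ k → X k ω = 1 ∨ X k ω = -1 := by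
  rw [ae_all_iff]
  intro k
  by_cases hk : 1 ≤ k
  · filter_upwards [hX.sign k hk] with ω h _ using h
  · exact Eventually.of_forall fun ω h => absurd h hk

variable {E : Type*} [NormedAddCommGroup E]

/-- The steps are almost surely signs, so a function of the first k of them takes at most 2^k
values, one for each set A of indices of positive steps. Every expectation thereby becomes a finite
sum of path probabilities, and no measurability of g is needed. -/
lemma ae_eq_sum_indicator (hX : IsElephantWalk P p M X) {k : ℕ} {g : (ℕ → ℝ) → E}
    (hg : DependsOn g (Set.Icc 1 k)) :
    (fun ω => g fun i => X i ω) =ᵐ[P] fun ω => ∑ A ∈ (Finset.Icc 1 k).powerset,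
      (pathEvent X k (signPath A)).indicator (fun _ => g (signPath A)) ω := by
  filter_upwards [hX.ae_sign] with ω hω
  classical
  set B := (Finset.Icc 1 k).filter fun i => X i ω = 1 with hB
  have hXB : ∀ i ∈ Finset.Icc 1 k, X i ω = signPath B i := by
    intro i hi
    rcases hω i (Finset.mem_Icc.1 hi).1 with h | h
    · have : i ∈ B := Finset.mem_filter.2 ⟨hi, h⟩
      simp [signPath, this, h]
    · have : i ∉ B := fun hh => by
        have := (Finset.mem_filter.1 hh).2
        linarith
      simp [signPath, this, h]
  rw [Finset.sum_eq_single B]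
  · rw [Set.indicator_of_mem (show ω ∈ pathEvent X k (signPath B) from hXB)]
    exact hg fun i hi => hXB i (Finset.mem_Icc.2 hi)
  · intro A hA hAB
    refine Set.indicator_of_notMem (fun hmem => hAB ?_) _
    ext i
    rw [hB, Finset.mem_filter]
    constructor
    · intro hi
      have hi' := Finset.mem_powerset.1 hA hi
      exact ⟨hi', by rw [hmem i hi']; simp [signPath, hi]⟩
    · rintro ⟨hi, h⟩
      by_contra hn
      have := hmem i hi
      rw [h] at this
      simp only [signPath, hn, if_false] at this
      norm_num at this
  · intro h
    exact absurd (Finset.mem_powerset.2 (Finset.filter_subset _ _)) h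

lemma integrable [IsFiniteMeasure P] (hX : IsElephantWalk P p M X) {k : ℕ} {g : (ℕ → ℝ) → E}
    (hg : DependsOn g (Set.Icc 1 k)) : Integrable (fun ω => g fun i => X i ω) P := by
  refine Integrable.congr ?_ (hX.ae_eq_sum_indicator hg).symm
  exact integrable_finsetSum _ fun A _ =>
    (integrable_const _).indicator (hX.measurableSet_pathEvent _ _)

variable [NormedSpace ℝ E]

lemma integral_eq_sum [IsFiniteMeasure P] [CompleteSpace E] (hX : IsElephantWalk P p M X)
    {k : ℕ} {g : (ℕ → ℝ) → E} (hg : DependsOn g (Set.Icc 1 k)) :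
    ∫ ω, g (fun i => X i ω) ∂P = ∑ A ∈ (Finset.Icc 1 k).powerset,
      P.real (pathEvent X k (signPath A)) • g (signPath A) := by
  rw [integral_congr_ae (hX.ae_eq_sum_indicator hg), integral_finsetSum]
  · exact Finset.sum_congr rfl fun A _ => by
      rw [integral_indicator_const _ (hX.measurableSet_pathEvent _ _)]
  · exact fun A _ => (integrable_const _).indicator (hX.measurableSet_pathEvent _ _)

/-- Given the first `k` steps, the expectation of the step number `k + 1` is `2 * p - 1` times the
average of the steps in the memory. -/
lemma integral_next_smul [IsFiniteMeasure P] [CompleteSpace E] (hX : IsElephantWalk P p M X)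
    {k : ℕ} (hk : 1 ≤ k) (hM : M k ⊆ Finset.Icc 1 k) {g : (ℕ → ℝ) → E}
    (hg : DependsOn g (Set.Icc 1 k)) :
    ∫ ω, X (k + 1) ω • g (fun i => X i ω) ∂P =
      ∫ ω, ((2 * p - 1) * ((∑ i ∈ M k, X i ω) / (M k).card)) • g (fun i => X i ω) ∂P := by
  have h1 : DependsOn (fun x : ℕ → ℝ => x (k + 1) • g x) (Set.Icc 1 (k + 1)) := by
    intro x y h
    have e : x (k + 1) = y (k + 1) := h _ ⟨by omega, le_rfl⟩
    have e' : g x = g y := hg fun i hi => h i ⟨hi.1, hi.2.trans (by omega)⟩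
    simp only [e, e']
  have h2 : DependsOn (fun x : ℕ → ℝ =>
      ((2 * p - 1) * ((∑ i ∈ M k, x i) / (M k).card)) • g x) (Set.Icc 1 k) := by
    intro x y h
    have e : ∑ i ∈ M k, x i = ∑ i ∈ M k, y i :=
      Finset.sum_congr rfl fun i hi => h i (Finset.mem_Icc.1 (hM hi))
    simp only [e, hg h]
  -- The paths of length k + 1 are paired according to their first k steps: A and `insert (k + 1) A`
  -- are the two continuations of the same path.
  rw [hX.integral_eq_sum h1, hX.integral_eq_sum h2,
    ← Finset.insert_Icc_right_eq_Icc_add_one (show 1 ≤ k + 1 by omega),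
    Finset.sum_powerset_insert (by simp), ← Finset.sum_add_distrib]
  refine Finset.sum_congr rfl fun A hA => ?_
  have hkA : k + 1 ∉ A := fun h => by
    have := Finset.mem_Icc.1 (Finset.mem_powerset.1 hA h); omega
  have hstep : ∀ x : ℕ → ℝ, (∀ i, x i = 1 ∨ x i = -1) → P.real (pathEvent X (k + 1) x) =
      P.real (pathEvent X k x) * nextStepProb p (M k) x (x (k + 1)) := hX.step k hk
  have hins : ∀ i ∈ Finset.Icc 1 k, signPath (insert (k + 1) A) i = signPath A i := fun i hi =>
    signPath_insert_of_ne (by have := Finset.mem_Icc.1 hi; omega)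
  have v1 : signPath A (k + 1) = -1 := by simp [signPath, hkA]
  have v2 : signPath (insert (k + 1) A) (k + 1) = 1 := by simp [signPath]
  rw [hstep _ (signPath_sign _), hstep _ (signPath_sign _), pathEvent_congr X hins,
    nextStepProb_congr (fun i hi => hins i (hM hi)), v1, v2,
    hg (fun i hi => hins i (Finset.mem_Icc.2 hi)),
    ← nextStepProb_one_sub_neg_one (fun i _ => signPath_sign A i)]
  module

lemma real_pathEvent_one [IsProbabilityMeasure P] (hX : IsElephantWalk P p M X)
    {x : ℕ → ℝ} (hx : x 1 = 1 ∨ x 1 = -1) :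
    P.real (pathEvent X 1 x) = if x 1 = 1 then p else 1 - p := by
  have hset : pathEvent X 1 x = {ω | X 1 ω = x 1} := by ext; simp [pathEvent]
  rw [hset]
  rcases hx with h | h <;> rw [h]
  · simpa using hX.first
  · have hm : MeasurableSet {ω | X 1 ω = 1} :=
      hX.measurable 1 le_rfl (measurableSet_singleton 1)
    have : P.real {ω | X 1 ω = -1} = P.real {ω | X 1 ω = 1}ᶜ := by
      refine measureReal_congr ?_
      filter_upwards [hX.sign 1 le_rfl] with ω hω
      refine propext ?_
      change X 1 ω = -1 ↔ ¬ X 1 ω = 1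
      rcases hω with h | h <;> rw [h] <;> norm_num
    rw [this, probReal_compl_eq_one_sub hm, hX.first]
    norm_num

lemma integral_first [IsProbabilityMeasure P] [CompleteSpace E] (hX : IsElephantWalk P p M X)
    (f : ℝ → E) : ∫ ω, f (X 1 ω) ∂P = p • f 1 + (1 - p) • f (-1) := by
  have hg : DependsOn (fun x : ℕ → ℝ => f (x 1)) (Set.Icc 1 1) := by
    intro x y h
    simp only [h 1 ⟨le_rfl, le_rfl⟩]
  rw [hX.integral_eq_sum hg]
  have : (Finset.Icc 1 1).powerset = {∅, {1}} := by decide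
  rw [this, Finset.sum_pair (by decide), hX.real_pathEvent_one (signPath_sign _ 1),
    hX.real_pathEvent_one (signPath_sign _ 1)]
  norm_num [signPath]
  abel

/-- The law of the first `n` steps is determined by the parameter and the memories. -/
lemma integral_eq_integral [IsProbabilityMeasure P] [CompleteSpace E]
    (hX : IsElephantWalk P p M X)
    {Ω' : Type*} [MeasurableSpace Ω'] {P' : Measure Ω'} [IsProbabilityMeasure P']
    {M' : ℕ → Finset ℕ} {X' : ℕ → Ω' → ℝ} (hX' : IsElephantWalk P' p M' X') {n : ℕ}
    (hM : ∀ k, 1 ≤ k → k < n → M k = M' k) {g : (ℕ → ℝ) → E}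
    (hg : DependsOn g (Set.Icc 1 n)) :
    ∫ ω, g (fun i => X i ω) ∂P = ∫ ω, g (fun i => X' i ω) ∂P' := by
  have key : ∀ x : ℕ → ℝ, (∀ i, x i = 1 ∨ x i = -1) → ∀ k ≤ n,
      P.real (pathEvent X k x) = P'.real (pathEvent X' k x) := by
    intro x hx k
    induction k with
    | zero => intro _; simp [pathEvent]
    | succ k ih =>
      intro hkn
      rcases Nat.eq_zero_or_pos k with rfl | hk
      · rw [zero_add, hX.real_pathEvent_one (hx 1), hX'.real_pathEvent_one (hx 1)]
      · have e1 := hX.step k hk x hx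
        have e2 := hX'.step k hk x hx
        rw [← hM k hk (by omega)] at e2
        have := ih (by omega)
        unfold pathEvent at this ⊢
        rw [e1, e2, this]
  rw [hX.integral_eq_sum hg, hX'.integral_eq_sum hg]
  exact Finset.sum_congr rfl fun A _ => by rw [key _ (signPath_sign A) n le_rfl]

end IsElephantWalk

/-! ### Asymptotics of the martingale weights -/

/-- The weights `c k` for which `c k * position W k` is a martingale for the elephant random walk
`W` with full memory and `2 * p - 1 = a`. -/
noncomputable def weight (a : ℝ) (k : ℕ) : ℝ := ∏ j ∈ Finset.range k, (1 + a / (j : ℝ))⁻¹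

/-- The sum of the squares of the first `n` weights. -/
noncomputable def weightSq (a : ℝ) (n : ℕ) : ℝ := ∑ k ∈ Finset.range n, weight a (k + 1) ^ 2

lemma one_add_div_pos {a : ℝ} (ha : -1 < a) (j : ℕ) : 0 < 1 + a / (j : ℝ) := by
  rcases Nat.eq_zero_or_pos j with rfl | hj
  · simp
  · have hj' : (1 : ℝ) ≤ j := by exact_mod_cast hj
    have : 0 < (j + a) / (j : ℝ) := div_pos (by linarith) (by linarith)
    rwa [add_div, div_self (by linarith)] at this

lemma weight_pos {a : ℝ} (ha : -1 < a) (k : ℕ) : 0 < weight a k :=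
  Finset.prod_pos fun j _ => inv_pos.2 (one_add_div_pos ha j)

lemma weight_succ_mul {a : ℝ} (ha : -1 < a) (k : ℕ) :
    weight a (k + 1) * (1 + a / (k : ℝ)) = weight a k := by
  rw [weight, Finset.prod_range_succ, mul_assoc, inv_mul_cancel₀ (one_add_div_pos ha k).ne',
    mul_one, weight]

/-- The only factor has j = 0, where a / 0 = 0 makes it equal to 1. The product thus effectively
starts at j = 1. -/
lemma weight_one (a : ℝ) : weight a 1 = 1 := by simp [weight]

lemma weightSq_succ (a : ℝ) (n : ℕ) :
    weightSq a (n + 1) = weightSq a n + weight a (n + 1) ^ 2 := by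
  rw [weightSq, Finset.sum_range_succ, weightSq]

lemma weightSq_nonneg (a : ℝ) (n : ℕ) : 0 ≤ weightSq a n :=
  Finset.sum_nonneg fun _ _ => sq_nonneg _

lemma weightSq_mono (a : ℝ) : Monotone (weightSq a) :=
  monotone_nat_of_le_succ fun n => by rw [weightSq_succ]; nlinarith [sq_nonneg (weight a (n + 1))]

/-- A telescoping identity: c_n = c_{n+1}(1 + a/n) shows that n c_n² grows by c_{n+1}² (1 - 2a -
a²/n) from n to n + 1. The sign of 1 - 2a then separates divergence from boundedness of the sum of
squares. The summand k = 0 vanishes because a² / 0 = 0. -/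
lemma mul_weight_sq {a : ℝ} (ha : -1 < a) {n : ℕ} (hn : 1 ≤ n) :
    n * weight a n ^ 2 = 2 * a + (1 - 2 * a) * weightSq a n -
      ∑ k ∈ Finset.range n, weight a (k + 1) ^ 2 * (a ^ 2 / k) := by
  induction n, hn using Nat.le_induction with
  | base => simp [weightSq, weight_one]
  | succ n hn ih =>
    have hn' : (n : ℝ) ≠ 0 := by positivity
    rw [weightSq_succ, Finset.sum_range_succ]
    rw [← weight_succ_mul ha n] at ih
    have : (n : ℝ) * (weight a (n + 1) * (1 + a / n)) ^ 2 =
      weight a (n + 1) ^ 2 * (n + 2 * a + a ^ 2 / n) := by field_simp; ring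
    push_cast
    linear_combination ih - this

/-- The weight is (n + 1)! / ((1 + a)(2 + a)⋯(n + 1 + a)), which is Euler's approximation of Γ(1 +
a) up to elementary factors. -/
lemma weight_add_two {a : ℝ} (ha : -1 < a) {n : ℕ} (hn : 1 ≤ n) :
    weight a (n + 2) = Real.GammaSeq (1 + a) n * (n + 1) / (n : ℝ) ^ (1 + a) := by
  have hw : weight a (n + 2) * ∏ j ∈ Finset.range (n + 1), (1 + a + j) = (n + 1).factorial := by
    clear hn
    induction n with
    | zero =>
      have := weight_succ_mul ha 1
      rw [weight_one] at this
      simp at this ⊢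
      exact this
    | succ n ih =>
      rw [Finset.prod_range_succ, Nat.factorial_succ (n + 1)]
      push_cast
      rw [← ih, ← weight_succ_mul ha (n + 2)]
      push_cast
      have : (n : ℝ) + 2 ≠ 0 := by positivity
      field_simp
      ring
  have hp : ∏ j ∈ Finset.range (n + 1), (1 + a + (j : ℝ)) ≠ 0 :=
    Finset.prod_ne_zero_iff.2 fun j _ => by
      have : (0 : ℝ) ≤ j := j.cast_nonneg
      linarith
  have hn' : (0 : ℝ) < (n : ℝ) ^ (1 + a) := Real.rpow_pos_of_pos (by exact_mod_cast hn) _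
  rw [Real.GammaSeq, eq_div_iff hn'.ne', div_mul_eq_mul_div, eq_div_iff hp, mul_right_comm, hw,
    Nat.factorial_succ]
  push_cast
  ring

lemma tendsto_weight_mul_rpow {a : ℝ} (ha : -1 < a) :
    Tendsto (fun n : ℕ => weight a n * (n : ℝ) ^ a) atTop (𝓝 (Real.Gamma (1 + a))) := by
  rw [← tendsto_add_atTop_iff_nat 2]
  have h1 : Tendsto (fun n : ℕ => 1 + 1 / (n : ℝ)) atTop (𝓝 1) := by
    simpa using (tendsto_one_div_atTop_nhds_zero_nat (𝕜 := ℝ)).const_add 1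
  have h2 : Tendsto (fun n : ℕ => (1 + 2 * (1 / (n : ℝ))) ^ a) atTop (𝓝 1) := by
    have : Tendsto (fun n : ℕ => 1 + 2 * (1 / (n : ℝ))) atTop (𝓝 1) := by
      simpa using ((tendsto_one_div_atTop_nhds_zero_nat (𝕜 := ℝ)).const_mul 2).const_add 1
    simpa using this.rpow_const (p := a) (Or.inl one_ne_zero)
  have h3 := ((Real.GammaSeq_tendsto_Gamma (1 + a)).mul h1).mul h2
  rw [mul_one, mul_one] at h3
  -- The factors of `h1` and `h2` are (n + 1)/n and ((n + 2)/n)^a; the second compensates for the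
  -- shift of the index by 2.
  refine h3.congr' ?_
  filter_upwards [eventually_ge_atTop 1] with n hn
  have hn' : (0 : ℝ) < n := by exact_mod_cast hn
  rw [weight_add_two ha hn, Real.rpow_add hn', Real.rpow_one,
    show 1 + 2 * (1 / (n : ℝ)) = ((n + 2 : ℕ) : ℝ) / n by push_cast; field_simp,
    Real.div_rpow (by positivity) hn'.le]
  field_simp

/-- By `mul_weight_sq`, (1 - 2a) V_n ≥ n c_n² - 2a, and n c_n² is of order n^{1 - 2a}. -/
lemma tendsto_weightSq_atTop_of_lt {a : ℝ} (ha : -1 < a) (ha' : a < 1 / 2) :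
    Tendsto (weightSq a) atTop atTop := by
  have hG : 0 < Real.Gamma (1 + a) := Real.Gamma_pos_of_pos (by linarith)
  have h1 : Tendsto (fun n : ℕ => (weight a n * (n : ℝ) ^ a) ^ 2 * (n : ℝ) ^ (1 - 2 * a))
      atTop atTop :=
    ((tendsto_weight_mul_rpow ha).pow 2).pos_mul_atTop (by positivity)
      ((tendsto_rpow_atTop (by linarith)).comp tendsto_natCast_atTop_atTop)
  have h2 : Tendsto (fun n : ℕ => (1 - 2 * a) * weightSq a n) atTop atTop := by
    refine tendsto_atTop_mono' _ ?_ (tendsto_atTop_add_const_right _ (-(2 * a)) h1)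
    filter_upwards [eventually_ge_atTop 1] with n hn
    have hn' : (0 : ℝ) < n := by exact_mod_cast hn
    have e : (weight a n * (n : ℝ) ^ a) ^ 2 * (n : ℝ) ^ (1 - 2 * a) = n * weight a n ^ 2 := by
      rw [mul_pow, ← Real.rpow_natCast ((n : ℝ) ^ a) 2, ← Real.rpow_mul hn'.le, mul_assoc,
        ← Real.rpow_add hn']
      norm_num
      ring_nf
      simp
    have := mul_weight_sq ha hn
    have hs : 0 ≤ ∑ k ∈ Finset.range n, weight a (k + 1) ^ 2 * (a ^ 2 / k) :=
      Finset.sum_nonneg fun _ _ => by positivity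
    linarith
  exact (tendsto_const_mul_atTop_of_pos (by linarith)).1 h2

/-- A weighted Cesàro lemma. -/
lemma tendsto_sum_weight_mul_div {a : ℝ} (hv : Tendsto (weightSq a) atTop atTop) {e : ℕ → ℝ}
    (he : Tendsto e atTop (𝓝 0)) :
    Tendsto (fun n => (∑ k ∈ Finset.range n, weight a (k + 1) ^ 2 * e k) / weightSq a n)
      atTop (𝓝 0) := by
  have h : (fun k => weight a (k + 1) ^ 2 * e k) =o[atTop] fun k => weight a (k + 1) ^ 2 := by
    simpa using (Asymptotics.isBigO_refl (fun k => weight a (k + 1) ^ 2) atTop).mul_isLittleO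
      ((Asymptotics.isLittleO_one_iff ℝ).2 he)
  exact (h.sum_range (fun _ => sq_nonneg _) hv).tendsto_div_nhds_zero

/-- Divide `mul_weight_sq` by V_n; the last sum becomes a weighted average of a²/k, which tends to
0. -/
lemma tendsto_weightSq_div_of_lt {a : ℝ} (ha : -1 < a) (ha' : a < 1 / 2) :
    Tendsto (fun n : ℕ => weightSq a n / (n * weight a n ^ 2)) atTop (𝓝 (1 / (1 - 2 * a))) := by
  have hv := tendsto_weightSq_atTop_of_lt ha ha'
  have h1 : Tendsto (fun n : ℕ => n * weight a n ^ 2 / weightSq a n) atTop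
      (𝓝 (1 - 2 * a)) := by
    have h2 := tendsto_sum_weight_mul_div hv
      (tendsto_const_div_atTop_nhds_zero_nat (a ^ 2))
    have h3 : Tendsto (fun n => 2 * a / weightSq a n) atTop (𝓝 0) := hv.const_div_atTop _
    have h4 := (h3.add (tendsto_const_nhds (x := 1 - 2 * a))).sub h2
    rw [zero_add, sub_zero] at h4
    refine h4.congr' ?_
    filter_upwards [eventually_ge_atTop 1, hv.eventually_gt_atTop 0] with n hn hn'
    rw [mul_weight_sq ha hn, sub_div, add_div, mul_div_assoc (1 - 2 * a), div_self hn'.ne',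
      mul_one]
  simpa [one_div] using h1.inv₀ (by linarith)

lemma tendsto_mul_weight_sq_half :
    Tendsto (fun n : ℕ => n * weight (1 / 2) n ^ 2) atTop (𝓝 (Real.Gamma (1 + 1 / 2) ^ 2)) := by
  refine ((tendsto_weight_mul_rpow (a := 1 / 2) (by norm_num)).pow 2).congr fun n => ?_
  rw [mul_pow, ← Real.sqrt_eq_rpow, Real.sq_sqrt n.cast_nonneg, mul_comm]

/-- Here c_k² ~ Γ(3/2)²/k, so the sum is compared with the harmonic sum, which is asymptotic to log
n. -/
lemma tendsto_weightSq_div_log :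
    Tendsto (fun n : ℕ => weightSq (1 / 2) n / Real.log n) atTop
      (𝓝 (Real.Gamma (1 + 1 / 2) ^ 2)) := by
  set G := Real.Gamma (1 + 1 / 2) ^ 2 with hG
  have hlog : Tendsto (fun n : ℕ => Real.log n) atTop atTop :=
    Real.tendsto_log_atTop.comp tendsto_natCast_atTop_atTop
  have hH : Tendsto (fun n : ℕ => ∑ i ∈ Finset.range n, 1 / ((i : ℝ) + 1)) atTop atTop :=
    Real.tendsto_sum_range_one_div_nat_succ_atTop
  have hHl : Tendsto (fun n : ℕ => (∑ i ∈ Finset.range n, 1 / ((i : ℝ) + 1)) / Real.log n) atTop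
      (𝓝 1) := by
    have := (Real.tendsto_harmonic_sub_log.div_atTop hlog).add (tendsto_const_nhds (x := (1 : ℝ)))
    rw [zero_add] at this
    refine this.congr' ?_
    filter_upwards [hlog.eventually_gt_atTop 0] with n hn
    rw [sub_div, div_self hn.ne', sub_add_cancel]
    simp [harmonic]
  have h0 : Tendsto (fun n : ℕ => ((n : ℝ) + 1) * weight (1 / 2) (n + 1) ^ 2 - G) atTop (𝓝 0) := by
    have := ((tendsto_add_atTop_iff_nat 1).2 tendsto_mul_weight_sq_half).sub_const G
    rw [sub_self] at this
    exact this.congr fun n => by push_cast; ring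
  have h1 : (fun n : ℕ => (((n : ℝ) + 1) * weight (1 / 2) (n + 1) ^ 2 - G) * (1 / ((n : ℝ) + 1)))
      =o[atTop] fun n : ℕ => 1 / ((n : ℝ) + 1) := by
    simpa using ((Asymptotics.isLittleO_one_iff ℝ).2 h0).mul_isBigO
      (Asymptotics.isBigO_refl (fun n : ℕ => 1 / ((n : ℝ) + 1)) atTop)
  have h2 := (h1.sum_range (fun n => by positivity) hH).tendsto_div_nhds_zero
  have h3 := (h2.add (tendsto_const_nhds (x := G))).mul hHl
  rw [zero_add, mul_one] at h3
  refine h3.congr' ?_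
  filter_upwards [hH.eventually_gt_atTop 0] with n hn
  rw [div_add' _ _ _ hn.ne', div_mul_div_cancel₀ hn.ne', weightSq, Finset.mul_sum,
    ← Finset.sum_add_distrib]
  congr 1
  refine Finset.sum_congr rfl fun i _ => ?_
  have : (i : ℝ) + 1 ≠ 0 := by positivity
  field_simp
  ring

lemma tendsto_weightSq_half_div :
    Tendsto (fun n : ℕ => weightSq (1 / 2) n / (n * weight (1 / 2) n ^ 2 * Real.log n)) atTop
      (𝓝 1) := by
  have hG : 0 < Real.Gamma (1 + 1 / 2) := Real.Gamma_pos_of_pos (by norm_num)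
  have := tendsto_weightSq_div_log.div tendsto_mul_weight_sq_half (by positivity)
  rw [div_self (by positivity)] at this
  exact this.congr fun n => by simp only [Pi.div_apply]; rw [div_div]; ring_nf

lemma tendsto_weightSq_half_atTop : Tendsto (weightSq (1 / 2)) atTop atTop := by
  have hG : 0 < Real.Gamma (1 + 1 / 2) := Real.Gamma_pos_of_pos (by norm_num)
  have hlog : Tendsto (fun n : ℕ => Real.log n) atTop atTop :=
    Real.tendsto_log_atTop.comp tendsto_natCast_atTop_atTop
  refine (tendsto_weightSq_div_log.pos_mul_atTop (by positivity) hlog).congr' ?_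
  filter_upwards [hlog.eventually_gt_atTop 0] with n hn
  rw [div_mul_cancel₀ _ hn.ne']

/-- In `mul_weight_sq` the coefficient 1 - 2a is now negative and all other varying terms have a
favourable sign, which leaves (2a - 1) V_n ≤ 2a. -/
lemma weightSq_le_of_lt {a : ℝ} (ha : 1 / 2 < a) (n : ℕ) :
    weightSq a n ≤ 2 * a / (2 * a - 1) := by
  rw [le_div_iff₀ (by linarith)]
  rcases Nat.eq_zero_or_pos n with rfl | hn
  · simp [weightSq]; linarith
  · have := mul_weight_sq (a := a) (by linarith) hn
    have hs : 0 ≤ ∑ k ∈ Finset.range n, weight a (k + 1) ^ 2 * (a ^ 2 / k) :=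
      Finset.sum_nonneg fun _ _ => by positivity
    have : 0 ≤ (n : ℝ) * weight a n ^ 2 := by positivity
    linarith

/-! ### The characteristic function of a single step -/

/-- A random sign with mean y has characteristic function cos θ + i y sin θ. It is compared with
that of a normal variable with mean y and variance 1; as the true variance is 1 - y², an error θ² y²
appears besides the cubic one. Taylor expansion settles |θ| ≤ 1. For |θ| > 1 three terms of norm at
most 1 remain, whence the constant 3. -/
lemma norm_cos_add_sin_sub_exp_le (θ : ℝ) {y : ℝ} (hy : |y| ≤ 1) :
    ‖((Real.cos θ : ℂ) + y * Real.sin θ * Complex.I) -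
      Complex.exp (θ * y * Complex.I) * (Real.exp (-θ ^ 2 / 2) : ℂ)‖ ≤
      3 * |θ| ^ 3 + θ ^ 2 * y ^ 2 := by
  have hexp : ‖Complex.exp (θ * y * Complex.I)‖ = 1 := by
    rw [← Complex.ofReal_mul, Complex.norm_exp_ofReal_mul_I]
  have hv0 : 0 < Real.exp (-θ ^ 2 / 2) := Real.exp_pos _
  have hv1 : Real.exp (-θ ^ 2 / 2) ≤ 1 := Real.exp_le_one_iff.2 (by nlinarith [sq_nonneg θ])
  have hyv : ∀ r : ℝ, ‖(y : ℂ) * r * Complex.I‖ = |y| * |r| := fun r => by simp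
  rcases le_or_gt |θ| 1 with hθ | hθ
  · have hθ2 : θ ^ 2 = |θ| ^ 2 := (sq_abs θ).symm
    have h35 : |θ| ^ 5 ≤ |θ| ^ 3 := pow_le_pow_of_le_one (abs_nonneg _) hθ (by norm_num)
    have h34 : |θ| ^ 4 ≤ |θ| ^ 3 := pow_le_pow_of_le_one (abs_nonneg _) hθ (by norm_num)
    have hc : |Real.cos θ - (1 - θ ^ 2 / 2)| ≤ |θ| ^ 3 * (5 / 96) :=
      (Real.cos_bound hθ).trans (by linarith)
    have hs : |Real.sin θ - θ| ≤ |θ| ^ 3 * (1 / 6 + 5 / 96) := by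
      have h1 := Real.sin_bound hθ
      have h2 : |Real.sin θ - θ| ≤ |Real.sin θ - (θ - θ ^ 3 / 6)| + |θ ^ 3 / 6| := by
        have := abs_sub (Real.sin θ - (θ - θ ^ 3 / 6)) (θ ^ 3 / 6)
        rwa [show Real.sin θ - (θ - θ ^ 3 / 6) - θ ^ 3 / 6 = Real.sin θ - θ by ring] at this
      rw [abs_div, abs_pow] at h2
      norm_num at h2
      have : 0 ≤ |θ| ^ 3 := by positivity
      linarith
    have hR1 : ‖Complex.exp (θ * y * Complex.I) - 1 - θ * y * Complex.I‖ ≤ θ ^ 2 * y ^ 2 := by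
      have hn : ‖(θ : ℂ) * y * Complex.I‖ = |θ| * |y| := by simp
      have := Complex.norm_exp_sub_one_sub_id_le (x := θ * y * Complex.I)
        (by rw [hn]; exact mul_le_one₀ hθ (abs_nonneg _) hy)
      rwa [hn, mul_pow, sq_abs, sq_abs] at this
    have hR2 : |Real.exp (-θ ^ 2 / 2) - 1 - (-θ ^ 2 / 2)| ≤ |θ| ^ 3 * (1 / 4) := by
      have hn : ‖-θ ^ 2 / 2‖ = |θ| ^ 2 / 2 := by simp
      have := Real.norm_exp_sub_one_sub_id_le (x := -θ ^ 2 / 2)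
        (by rw [hn]; nlinarith [abs_nonneg θ])
      rw [hn, Real.norm_eq_abs] at this
      refine this.trans ?_
      calc (|θ| ^ 2 / 2) ^ 2 = |θ| ^ 4 * (1 / 4) := by ring
        _ ≤ _ := by linarith
    have hv : |Real.exp (-θ ^ 2 / 2) - 1| ≤ |θ| ^ 2 * (1 / 2) := by
      have := Real.add_one_le_exp (-θ ^ 2 / 2)
      rw [abs_le]
      constructor <;> nlinarith [sq_nonneg θ]
    have key : ((Real.cos θ : ℂ) + y * Real.sin θ * Complex.I) -
        Complex.exp (θ * y * Complex.I) * (Real.exp (-θ ^ 2 / 2) : ℂ) =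
        ((Real.cos θ - (1 - θ ^ 2 / 2) : ℝ) : ℂ) +
        y * ((Real.sin θ - θ : ℝ) : ℂ) * Complex.I -
        (Complex.exp (θ * y * Complex.I) - 1 - θ * y * Complex.I) *
          (Real.exp (-θ ^ 2 / 2) : ℂ) -
        y * ((θ * (Real.exp (-θ ^ 2 / 2) - 1) : ℝ) : ℂ) * Complex.I -
        ((Real.exp (-θ ^ 2 / 2) - 1 - (-θ ^ 2 / 2) : ℝ) : ℂ) := by
      push_cast
      ring
    rw [key]
    have n2 : ‖(y : ℂ) * ((Real.sin θ - θ : ℝ) : ℂ) * Complex.I‖ ≤ |θ| ^ 3 * (1 / 6 + 5 / 96) := by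
      rw [hyv]
      exact (mul_le_of_le_one_left (abs_nonneg _) hy).trans hs
    have n3 : ‖(Complex.exp (θ * y * Complex.I) - 1 - θ * y * Complex.I) *
        (Real.exp (-θ ^ 2 / 2) : ℂ)‖ ≤ θ ^ 2 * y ^ 2 := by
      rw [norm_mul, Complex.norm_real, Real.norm_eq_abs, abs_of_pos hv0]
      exact (mul_le_of_le_one_right (norm_nonneg _) hv1).trans hR1
    have n4 : ‖(y : ℂ) * ((θ * (Real.exp (-θ ^ 2 / 2) - 1) : ℝ) : ℂ) * Complex.I‖ ≤
        |θ| ^ 3 * (1 / 2) := by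
      rw [hyv, abs_mul]
      refine (mul_le_of_le_one_left (by positivity) hy).trans ?_
      calc |θ| * |Real.exp (-θ ^ 2 / 2) - 1| ≤ |θ| * (|θ| ^ 2 * (1 / 2)) := by gcongr
        _ = _ := by ring
    have n1 : ‖((Real.cos θ - (1 - θ ^ 2 / 2) : ℝ) : ℂ)‖ ≤ |θ| ^ 3 * (5 / 96) := by
      rw [Complex.norm_real]; exact hc
    have n5 : ‖((Real.exp (-θ ^ 2 / 2) - 1 - (-θ ^ 2 / 2) : ℝ) : ℂ)‖ ≤ |θ| ^ 3 * (1 / 4) := by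
      rw [Complex.norm_real]; exact hR2
    have hpos : 0 ≤ |θ| ^ 3 := by positivity
    refine (norm_sub_le_of_le (norm_sub_le_of_le (norm_sub_le_of_le (norm_add_le_of_le n1 n2) n3)
      n4) n5).trans ?_
    linarith
  · have h3 : 1 ≤ |θ| ^ 3 := one_le_pow₀ hθ.le
    have n1 : ‖(Real.cos θ : ℂ)‖ ≤ 1 := by
      rw [Complex.norm_real]; exact Real.abs_cos_le_one θ
    have n2 : ‖(y : ℂ) * (Real.sin θ : ℂ) * Complex.I‖ ≤ 1 := by
      rw [hyv]; exact mul_le_one₀ hy (abs_nonneg _) (Real.abs_sin_le_one θ)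
    have n3 : ‖Complex.exp (θ * y * Complex.I) * (Real.exp (-θ ^ 2 / 2) : ℂ)‖ ≤ 1 := by
      rw [norm_mul, hexp, one_mul, Complex.norm_real, Real.norm_eq_abs, abs_of_pos hv0]
      exact hv1
    refine (norm_sub_le_of_le (norm_add_le_of_le n1 n2) n3).trans ?_
    nlinarith [mul_nonneg (sq_nonneg θ) (sq_nonneg y)]

/-! ### Full memory: second moments and the central limit theorem -/

lemma position_succ {Ω : Type*} (X : ℕ → Ω → ℝ) (k : ℕ) (ω : Ω) :
    position X (k + 1) ω = position X k ω + X (k + 1) ω := by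
  rw [position, Finset.sum_Icc_succ_top (by omega), position]

lemma dependsOn_position {β : Type*} (φ : ℝ → β) (k : ℕ) :
    DependsOn (fun x : ℕ → ℝ => φ (∑ i ∈ Finset.Icc 1 k, x i)) (Set.Icc 1 k) := by
  intro x y h
  simp only [Finset.sum_congr rfl fun i hi => h i (Finset.mem_Icc.1 hi)]

namespace IsElephantWalk

variable {Ω : Type*} [MeasurableSpace Ω] {P : Measure Ω} {p : ℝ} {M : ℕ → Finset ℕ}
  {X : ℕ → Ω → ℝ}

lemma measurable_position (hX : IsElephantWalk P p M X) (k : ℕ) : Measurable (position X k) :=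
  Finset.measurable_sum _ fun i hi => hX.measurable i (Finset.mem_Icc.1 hi).1

lemma ae_abs_position_le (hX : IsElephantWalk P p M X) (k : ℕ) :
    ∀ᵐ ω ∂P, |position X k ω| ≤ k := by
  filter_upwards [hX.ae_sign] with ω hω
  refine (Finset.abs_sum_le_sum_abs _ _).trans ?_
  have : ∀ i ∈ Finset.Icc 1 k, |X i ω| ≤ 1 := fun i hi => by
    rcases hω i (Finset.mem_Icc.1 hi).1 with h | h <;> rw [h] <;> simp
  simpa using Finset.sum_le_card_nsmul _ _ _ this

lemma integrable_position [IsFiniteMeasure P] {E : Type*} [NormedAddCommGroup E]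
    (hX : IsElephantWalk P p M X) (φ : ℝ → E) (k : ℕ) :
    Integrable (fun ω => φ (position X k ω)) P :=
  hX.integrable (dependsOn_position φ k)

lemma integrable_next_smul_position [IsFiniteMeasure P] {E : Type*} [NormedAddCommGroup E]
    [NormedSpace ℝ E] (hX : IsElephantWalk P p M X) (φ : ℝ → E) (k : ℕ) :
    Integrable (fun ω => X (k + 1) ω • φ (position X k ω)) P := by
  have h : DependsOn (fun x : ℕ → ℝ => x (k + 1) • φ (∑ i ∈ Finset.Icc 1 k, x i))
      (Set.Icc 1 (k + 1)) := by
    intro x y h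
    have e : x (k + 1) = y (k + 1) := h _ ⟨by omega, le_rfl⟩
    have e' := dependsOn_position φ k fun i hi => h i ⟨hi.1, hi.2.trans (by omega)⟩
    simp only at e'
    simp only [e, e']
  exact hX.integrable h

/-- The conditional expectation of the next step in the case of full memory. -/
lemma integral_next_smul_position [IsFiniteMeasure P] {E : Type*} [NormedAddCommGroup E]
    [NormedSpace ℝ E] [CompleteSpace E] (hX : IsElephantWalk P p M X) {k : ℕ} (hk : 1 ≤ k)
    (hM : M k = fullMemory k) {g : (ℕ → ℝ) → E} (hg : DependsOn g (Set.Icc 1 k)) :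
    ∫ ω, X (k + 1) ω • g (fun i => X i ω) ∂P =
      ∫ ω, ((2 * p - 1) * (position X k ω / k)) • g (fun i => X i ω) ∂P := by
  have := hX.integral_next_smul hk (by rw [hM]; exact Finset.Subset.rfl) hg
  rw [hM] at this
  simpa [fullMemory, position] using this

lemma integral_next_smul_comp_position [IsFiniteMeasure P] {E : Type*} [NormedAddCommGroup E]
    [NormedSpace ℝ E] [CompleteSpace E] (hX : IsElephantWalk P p M X) {k : ℕ} (hk : 1 ≤ k)
    (hM : M k = fullMemory k) (φ : ℝ → E) :
    ∫ ω, X (k + 1) ω • φ (position X k ω) ∂P =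
      ∫ ω, ((2 * p - 1) * (position X k ω / k)) • φ (position X k ω) ∂P :=
  hX.integral_next_smul_position hk hM (dependsOn_position φ k)

lemma integral_position_sq_succ [IsProbabilityMeasure P] (hX : IsElephantWalk P p M X) {k : ℕ}
    (hk : 1 ≤ k) (hM : M k = fullMemory k) :
    ∫ ω, position X (k + 1) ω ^ 2 ∂P =
      (1 + 2 * (2 * p - 1) / k) * ∫ ω, position X k ω ^ 2 ∂P + 1 := by
  have h1 : ∫ ω, position X (k + 1) ω ^ 2 ∂P =
      ∫ ω, (position X k ω ^ 2 + X (k + 1) ω • (2 * position X k ω) + 1) ∂P := by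
    refine integral_congr_ae ?_
    filter_upwards [hX.sign (k + 1) (by omega)] with ω hω
    rw [position_succ, smul_eq_mul]
    rcases hω with h | h <;> rw [h] <;> ring
  have i1 := hX.integrable_position (fun t => t ^ 2) k
  have i2 := hX.integrable_next_smul_position (fun t => 2 * t) k
  have i3 : Integrable (fun ω => position X k ω ^ 2 + X (k + 1) ω • (2 * position X k ω)) P :=
    i1.add i2
  rw [h1, integral_add i3 (integrable_const _), integral_add i1 i2,
    hX.integral_next_smul_comp_position hk hM (fun t => 2 * t)]
  have h2 : ∫ ω, ((2 * p - 1) * (position X k ω / k)) • (2 * position X k ω) ∂P = 2 * (2 * p - 1) / k * ∫ ω, position X k ω ^ 2 ∂P := by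
    rw [← integral_const_mul]
    refine integral_congr_ae (Eventually.of_forall fun ω => ?_)
    simp only [smul_eq_mul]
    ring
  rw [h2]
  simp
  ring

/-- Induction on the recursion for the second moment, with 1 + 2a/k ≤ (1 + a/k)²: each step adds at
most c_{k+1}². -/
lemma weight_sq_mul_integral_position_sq_le [IsProbabilityMeasure P]
    (hX : IsElephantWalk P p M X) (hp : 0 < p) {n : ℕ}
    (hM : ∀ k, 1 ≤ k → k < n → M k = fullMemory k) {k : ℕ} (hk : k ≤ n) :
    weight (2 * p - 1) k ^ 2 * ∫ ω, position X k ω ^ 2 ∂P ≤ weightSq (2 * p - 1) k := by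
  rcases Nat.eq_zero_or_pos k with rfl | hk1
  · simp [position, weightSq]
  induction k, hk1 using Nat.le_induction with
  | base =>
    have : ∫ ω, position X 1 ω ^ 2 ∂P = 1 := by
      have := hX.integral_first (fun t => t ^ 2)
      simpa [position] using this
    simp [this, weight_one, weightSq]
  | succ k hk1 ih =>
    have ih := ih (by omega)
    rw [hX.integral_position_sq_succ hk1 (hM k hk1 (by omega)), weightSq_succ]
    set V := ∫ ω, position X k ω ^ 2 ∂P
    have hV : 0 ≤ V := integral_nonneg fun _ => sq_nonneg _
    rw [← weight_succ_mul (show -1 < 2 * p - 1 by linarith) k] at ih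
    set c := weight (2 * p - 1) (k + 1)
    have : 0 ≤ c ^ 2 * ((2 * p - 1) / k) ^ 2 * V := by positivity
    calc c ^ 2 * ((1 + 2 * (2 * p - 1) / k) * V + 1)
        = (c * (1 + (2 * p - 1) / k)) ^ 2 * V + c ^ 2 - c ^ 2 * ((2 * p - 1) / k) ^ 2 * V := by
          ring
      _ ≤ _ := by linarith

/-- Conditioning on the past puts the mean y = a S_k/k into `norm_cos_add_sin_sub_exp_le`. The
factor exp(iθy) merges with exp(iθS_k) and changes the frequency from θ to θ(1 + a/k). -/
lemma norm_integral_exp_succ_sub_le [IsProbabilityMeasure P]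
    (hX : IsElephantWalk P p M X) (hp0 : 0 < p) (hp1 : p < 1) {k : ℕ}
    (hk : 1 ≤ k) (hM : M k = fullMemory k) (θ : ℝ) :
    ‖∫ ω, Complex.exp (θ * position X (k + 1) ω * Complex.I) ∂P -
      (Real.exp (-θ ^ 2 / 2) : ℂ) * ∫ ω, Complex.exp
        ((θ * (1 + (2 * p - 1) / k) : ℝ) * position X k ω * Complex.I) ∂P‖ ≤
      3 * |θ| ^ 3 + θ ^ 2 * ((∫ ω, position X k ω ^ 2 ∂P) / k ^ 2) := by
  set a := 2 * p - 1 with ha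
  have ha1 : |a| ≤ 1 := abs_le.2 ⟨by linarith, by linarith⟩
  have hk' : (0 : ℝ) < k := by exact_mod_cast hk
  have h1 : ∫ ω, Complex.exp (θ * position X (k + 1) ω * Complex.I) ∂P =
      ∫ ω, (Complex.exp (θ * position X k ω * Complex.I) * Real.cos θ +
        X (k + 1) ω • (Complex.exp (θ * position X k ω * Complex.I) *
          (Real.sin θ * Complex.I))) ∂P := by
    refine integral_congr_ae ?_
    filter_upwards [hX.sign (k + 1) (by omega)] with ω hω
    have h1 := Complex.exp_mul_I θ
    have h2 := Complex.exp_mul_I (-θ)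
    rw [Complex.cos_neg, Complex.sin_neg] at h2
    rw [position_succ, Complex.real_smul, Complex.ofReal_add, mul_add, add_mul, Complex.exp_add]
    rcases hω with h | h <;> rw [h]
    · rw [Complex.ofReal_one, mul_one, one_mul, h1, Complex.ofReal_cos, Complex.ofReal_sin]
      ring
    · rw [show (θ : ℂ) * ((-1 : ℝ) : ℂ) * Complex.I = (-θ : ℂ) * Complex.I by push_cast; ring,
        h2, Complex.ofReal_cos, Complex.ofReal_sin]
      push_cast
      ring
  have i1 := hX.integrable_position
    (fun t => Complex.exp (θ * t * Complex.I) * Real.cos θ) k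
  have i2 := hX.integrable_next_smul_position
    (fun t => Complex.exp (θ * t * Complex.I) * (Real.sin θ * Complex.I)) k
  have i3 := hX.integrable_position (fun t => (a * (t / k)) •
    (Complex.exp (θ * t * Complex.I) * (Real.sin θ * Complex.I))) k
  have i4 := hX.integrable_position (fun t => (Real.exp (-θ ^ 2 / 2) : ℂ) *
    Complex.exp ((θ * (1 + a / k) : ℝ) * t * Complex.I)) k
  have i13 : Integrable (fun ω => Complex.exp (θ * position X k ω * Complex.I) * Real.cos θ +
      (a * (position X k ω / k)) • (Complex.exp (θ * position X k ω * Complex.I) *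
        (Real.sin θ * Complex.I))) P := i1.add i3
  have h2 := hX.integral_next_smul_comp_position hk hM
    (fun t => Complex.exp (θ * t * Complex.I) * (Real.sin θ * Complex.I))
  rw [h1, integral_add i1 i2, h2, ← integral_add i1 i3, ← integral_const_mul,
    ← integral_sub i13 i4]
  have hb : ∫ ω, (3 * |θ| ^ 3 + θ ^ 2 * (position X k ω ^ 2 / k ^ 2)) ∂P =
      3 * |θ| ^ 3 + θ ^ 2 * ((∫ ω, position X k ω ^ 2 ∂P) / k ^ 2) := by
    rw [integral_add (integrable_const _) (hX.integrable_position
      (fun t => θ ^ 2 * (t ^ 2 / k ^ 2)) k), integral_const_mul (θ ^ 2), integral_div]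
    simp
  rw [← hb]
  refine norm_integral_le_of_norm_le (hX.integrable_position
    (fun t => 3 * |θ| ^ 3 + θ ^ 2 * (t ^ 2 / k ^ 2)) k) ?_
  filter_upwards [hX.ae_abs_position_le k] with ω hω
  have hy : |a * (position X k ω / k)| ≤ 1 := by
    rw [abs_mul, abs_div, abs_of_pos hk']
    exact mul_le_one₀ ha1 (by positivity) ((div_le_one hk').2 hω)
  set w := position X k ω
  have hn : ‖Complex.exp (θ * w * Complex.I)‖ = 1 := by
    rw [← Complex.ofReal_mul, Complex.norm_exp_ofReal_mul_I]
  have e : Complex.exp (θ * w * Complex.I) * Real.cos θ + (a * (w / k)) •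
      (Complex.exp (θ * w * Complex.I) * (Real.sin θ * Complex.I)) -
      (Real.exp (-θ ^ 2 / 2) : ℂ) * Complex.exp ((θ * (1 + a / k) : ℝ) * w * Complex.I) =
      Complex.exp (θ * w * Complex.I) * (((Real.cos θ : ℂ) +
        ((a * (w / k) : ℝ) : ℂ) * Real.sin θ * Complex.I) -
      Complex.exp (θ * ((a * (w / k) : ℝ) : ℂ) * Complex.I) * (Real.exp (-θ ^ 2 / 2) : ℂ)) := by
    have : Complex.exp ((θ * (1 + a / k) : ℝ) * w * Complex.I) =
        Complex.exp (θ * w * Complex.I) *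
          Complex.exp (θ * ((a * (w / k) : ℝ) : ℂ) * Complex.I) := by
      rw [← Complex.exp_add]
      congr 1
      push_cast
      ring
    rw [this, Complex.real_smul]
    ring
  change ‖Complex.exp (θ * w * Complex.I) * Real.cos θ + (a * (w / k)) •
      (Complex.exp (θ * w * Complex.I) * (Real.sin θ * Complex.I)) -
      (Real.exp (-θ ^ 2 / 2) : ℂ) * Complex.exp ((θ * (1 + a / k) : ℝ) * w * Complex.I)‖ ≤ _
  rw [e, norm_mul, hn, one_mul]
  refine (norm_cos_add_sin_sub_exp_le θ hy).trans ?_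
  have : (a * (w / k)) ^ 2 ≤ w ^ 2 / k ^ 2 := by
    rw [mul_pow, div_pow]
    exact mul_le_of_le_one_left (by positivity) ((sq_le_one_iff_abs_le_one a).2 ha1)
  gcongr

/-- A quantitative central limit theorem for the walk with full memory. -/
lemma norm_integral_exp_sub_le [IsProbabilityMeasure P]
    (hX : IsElephantWalk P p M X) (hp0 : 0 < p) (hp1 : p < 1) {n : ℕ} (hn : 1 ≤ n)
    (hM : ∀ k, 1 ≤ k → k < n → M k = fullMemory k) (s : ℝ) :
    ‖∫ ω, Complex.exp ((s * weight (2 * p - 1) n : ℝ) * position X n ω * Complex.I) ∂P -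
      (Real.exp (-(s ^ 2 * weightSq (2 * p - 1) n) / 2) : ℂ)‖ ≤
      |s| + s ^ 2 / 2 + ∑ k ∈ Finset.range n, (3 * |s * weight (2 * p - 1) (k + 1)| ^ 3 +
        (s * weight (2 * p - 1) (k + 1)) ^ 2 *
          (weightSq (2 * p - 1) k / (weight (2 * p - 1) k ^ 2 * k ^ 2))) := by
  have ha : -1 < 2 * p - 1 := by linarith
  have hmain : ∀ k, 1 ≤ k → k ≤ n →
    ‖∫ ω, Complex.exp ((s * weight (2 * p - 1) k : ℝ) * position X k ω * Complex.I) ∂P -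
      (Real.exp (-(s ^ 2 * weightSq (2 * p - 1) k) / 2) : ℂ)‖ ≤
      |s| + s ^ 2 / 2 + ∑ k ∈ Finset.range k, (3 * |s * weight (2 * p - 1) (k + 1)| ^ 3 +
        (s * weight (2 * p - 1) (k + 1)) ^ 2 *
          (weightSq (2 * p - 1) k / (weight (2 * p - 1) k ^ 2 * k ^ 2))) := by
    intro k hk
    induction k, hk using Nat.le_induction with
    | base =>
      intro _
      have h1 : ‖∫ ω, Complex.exp (s * position X 1 ω * Complex.I) ∂P - 1‖ ≤ |s| := by
        have e1 : (1 : ℂ) = ∫ _, (1 : ℂ) ∂P := by simp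
        have e2 : |s| = ∫ _, |s| ∂P := by simp
        conv_lhs => rw [e1]
        rw [← integral_sub (hX.integrable_position (fun t => Complex.exp (s * t * Complex.I)) 1)
          (integrable_const _), e2]
        refine norm_integral_le_of_norm_le (integrable_const _) ?_
        filter_upwards [hX.ae_abs_position_le 1] with ω hω
        have := Real.norm_exp_I_mul_ofReal_sub_one_le (x := s * position X 1 ω)
        rw [mul_comm, Complex.ofReal_mul] at this
        refine this.trans ?_
        rw [Real.norm_eq_abs, abs_mul]
        exact mul_le_of_le_one_right (abs_nonneg _) (by simpa using hω)
      have h2 : ‖(1 : ℂ) - (Real.exp (-(s ^ 2) / 2) : ℂ)‖ ≤ s ^ 2 / 2 := by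
        rw [← Complex.ofReal_one, ← Complex.ofReal_sub, Complex.norm_real, Real.norm_eq_abs]
        have := Real.add_one_le_exp (-s ^ 2 / 2)
        have : Real.exp (-s ^ 2 / 2) ≤ 1 := Real.exp_le_one_iff.2 (by nlinarith [sq_nonneg s])
        rw [abs_le]
        constructor <;> nlinarith [sq_nonneg s]
      have h3 := norm_add_le_of_le h1 h2
      rw [sub_add_sub_cancel] at h3
      have hv : weightSq (2 * p - 1) 1 = 1 := by simp [weightSq, weight_one]
      rw [weight_one, hv, mul_one, mul_one]
      -- The summand k = 0 plays no role in the estimate and is only added as a nonnegative term.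
      refine h3.trans (le_add_of_nonneg_right (Finset.sum_nonneg fun k _ => ?_))
      have := weightSq_nonneg (2 * p - 1) k
      positivity
    | succ k hk ih =>
      intro hkn
      have ih := ih (by omega)
      rw [Finset.sum_range_succ]
      set a := 2 * p - 1
      set c := weight a (k + 1) with hc
      have h1 := hX.norm_integral_exp_succ_sub_le hp0 hp1 hk (hM k hk (by omega)) (s * c)
      -- With θ = s c_{k+1} the new frequency θ(1 + a/k) is exactly s c_k, so the one-step estimates
      -- can be chained. Errors simply add, because the Gaussian factors have norm at most 1.
      rw [mul_assoc, weight_succ_mul ha k] at h1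
      have hnorm : ‖(Real.exp (-(s * c) ^ 2 / 2) : ℂ)‖ ≤ 1 := by
        rw [Complex.norm_real, Real.norm_eq_abs, Real.abs_exp]
        exact Real.exp_le_one_iff.2 (by nlinarith [sq_nonneg (s * c)])
      have h2 := (norm_mul_le (Real.exp (-(s * c) ^ 2 / 2) : ℂ) _).trans
        ((mul_le_of_le_one_left (norm_nonneg _) hnorm).trans ih)
      have h3 : (∫ ω, position X k ω ^ 2 ∂P) / k ^ 2 ≤ weightSq a k / (weight a k ^ 2 * k ^ 2) := by
        rw [← div_div]
        gcongr
        rw [le_div_iff₀ (pow_pos (weight_pos ha k) 2), mul_comm]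
        exact hX.weight_sq_mul_integral_position_sq_le hp0 hM (by omega)
      have h4 := norm_add_le_of_le h1 h2
      rw [mul_sub, sub_add_sub_cancel, ← Complex.ofReal_mul, ← Real.exp_add] at h4
      rw [weightSq_succ, ← hc, show -(s ^ 2 * (weightSq a k + c ^ 2)) / 2 =
        -(s * c) ^ 2 / 2 + -(s ^ 2 * weightSq a k) / 2 by ring]
      refine h4.trans ?_
      have := mul_le_mul_of_nonneg_left h3 (sq_nonneg (s * c))
      linarith
  exact hmain n hn le_rfl

end IsElephantWalk

/-- Since s² V stays bounded, both sums reduce to weighted averages of null sequences with weights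
c_{k+1}². In the cubic sum one factor c_{k+1} is at most δ_k √V, where δ_k = c_{k+1}/√V_{k+1},
because V is monotone. -/
lemma tendsto_weight_error {a : ℝ} (ha : -1 < a) (hv : Tendsto (weightSq a) atTop atTop)
    (hc : Tendsto (fun n => weight a n ^ 2 / weightSq a n) atTop (𝓝 0))
    (he : Tendsto (fun n : ℕ => weightSq a n / (weight a n ^ 2 * n ^ 2)) atTop (𝓝 0))
    {m : ℕ → ℕ} (hm : Tendsto m atTop atTop) {s : ℕ → ℝ} {τ : ℝ}
    (hs : Tendsto (fun n => s n ^ 2 * weightSq a (m n)) atTop (𝓝 τ)) :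
    Tendsto (fun n => |s n| + s n ^ 2 / 2 + ∑ k ∈ Finset.range (m n),
      (3 * |s n * weight a (k + 1)| ^ 3 + (s n * weight a (k + 1)) ^ 2 *
        (weightSq a k / (weight a k ^ 2 * k ^ 2)))) atTop (𝓝 0) := by
  have hs2 : Tendsto (fun n => s n ^ 2) atTop (𝓝 0) := by
    refine (hs.div_atTop (hv.comp hm)).congr' ?_
    filter_upwards [(hv.comp hm).eventually_gt_atTop 0] with n hn
    exact mul_div_cancel_right₀ _ (ne_of_gt hn)
  have hs1 : Tendsto (fun n => |s n|) atTop (𝓝 0) := by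
    simpa [Real.sqrt_sq_eq_abs] using hs2.sqrt
  set δ : ℕ → ℝ := fun k => √(weight a (k + 1) ^ 2 / weightSq a (k + 1)) with hδ
  have hδ0 : Tendsto δ atTop (𝓝 0) := by
    simpa using ((tendsto_add_atTop_iff_nat 1).2 hc).sqrt
  have t1 := hs.mul ((tendsto_sum_weight_mul_div hv he).comp hm)
  have t2 := ((hs.mul hs.sqrt).mul ((tendsto_sum_weight_mul_div hv hδ0).comp hm)).const_mul 3
  have hub := ((hs1.add (hs2.div_const 2)).add t2).add t1
  simp only [mul_zero, add_zero, zero_div] at hub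
  refine squeeze_zero' (Eventually.of_forall fun n => ?_) ?_ hub
  · refine add_nonneg (by positivity) (Finset.sum_nonneg fun k _ => ?_)
    have := weightSq_nonneg a k
    positivity
  filter_upwards [(hv.comp hm).eventually_gt_atTop 0] with n hn
  simp only [Function.comp_apply] at hn ⊢
  rw [Finset.sum_add_distrib, add_assoc (|s n| + s n ^ 2 / 2)]
  gcongr
  · have hδk : ∀ k ∈ Finset.range (m n), weight a (k + 1) ≤ δ k * √(weightSq a (m n)) := by
      intro k hk
      have hkm : k + 1 ≤ m n := Finset.mem_range.1 hk
      have hpos : 0 < weightSq a (k + 1) := by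
        rw [weightSq_succ]
        have := weightSq_nonneg a k
        have := weight_pos ha (k + 1)
        positivity
      rw [hδ]
      simp only
      rw [Real.sqrt_div (sq_nonneg _), Real.sqrt_sq (weight_pos ha _).le, div_mul_eq_mul_div,
        le_div_iff₀ (Real.sqrt_pos.2 hpos)]
      exact mul_le_mul_of_nonneg_left (Real.sqrt_le_sqrt (weightSq_mono a hkm))
        (weight_pos ha _).le
    rw [Real.sqrt_mul (sq_nonneg _), Real.sqrt_sq_eq_abs, Finset.sum_div, Finset.mul_sum,
      Finset.mul_sum]
    refine Finset.sum_le_sum fun k hk => ?_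
    have hw := weight_pos ha (k + 1)
    rw [abs_mul, abs_of_pos hw]
    calc 3 * (|s n| * weight a (k + 1)) ^ 3
        = 3 * |s n| ^ 3 * weight a (k + 1) ^ 2 * weight a (k + 1) := by ring
      _ ≤ 3 * |s n| ^ 3 * weight a (k + 1) ^ 2 * (δ k * √(weightSq a (m n))) := by
        gcongr
        exact hδk k hk
      _ = _ := by
        rw [← sq_abs (s n)]
        field_simp
  · rw [Finset.sum_div, Finset.mul_sum]
    refine Finset.sum_le_sum fun k _ => le_of_eq ?_
    rw [mul_pow]
    field_simp

/-- The central limit theorem for elephant random walks with full memory, in terms of the weights,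
for a sequence of walks whose memories are full up to the times `m n`. -/
lemma tendsto_integral_exp_position {p : ℝ} (hp0 : 0 < p) (hp1 : p < 1)
    (hv : Tendsto (weightSq (2 * p - 1)) atTop atTop)
    (hc : Tendsto (fun n => weight (2 * p - 1) n ^ 2 / weightSq (2 * p - 1) n) atTop (𝓝 0))
    (he : Tendsto (fun n : ℕ => weightSq (2 * p - 1) n / (weight (2 * p - 1) n ^ 2 * n ^ 2))
      atTop (𝓝 0))
    {m : ℕ → ℕ} (hm : Tendsto m atTop atTop) {Ω : ℕ → Type*} [∀ n, MeasurableSpace (Ω n)]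
    {P : ∀ n, Measure (Ω n)} [∀ n, IsProbabilityMeasure (P n)] {X : ∀ n, ℕ → Ω n → ℝ}
    {M : ℕ → ℕ → Finset ℕ} (hX : ∀ n, IsElephantWalk (P n) p (M n) (X n))
    (hM : ∀ n k, 1 ≤ k → k < m n → M n k = fullMemory k) {r : ℕ → ℝ} {τ : ℝ}
    (hr : Tendsto (fun n => r n ^ 2 *
      (weightSq (2 * p - 1) (m n) / weight (2 * p - 1) (m n) ^ 2)) atTop (𝓝 τ)) :
    Tendsto (fun n => ∫ ω, Complex.exp (r n * position (X n) (m n) ω * Complex.I) ∂P n) atTop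
      (𝓝 (Real.exp (-τ / 2) : ℂ)) := by
  have ha : -1 < 2 * p - 1 := by linarith
  have hs : Tendsto (fun n => (r n / weight (2 * p - 1) (m n)) ^ 2 * weightSq (2 * p - 1) (m n))
      atTop (𝓝 τ) := hr.congr fun n => by rw [div_pow]; ring
  have h1 := tendsto_weight_error ha hv hc he hm hs
  have h2 : Tendsto (fun n => (Real.exp (-((r n / weight (2 * p - 1) (m n)) ^ 2 *
      weightSq (2 * p - 1) (m n)) / 2) : ℂ)) atTop (𝓝 (Real.exp (-τ / 2) : ℂ)) :=
    (Complex.continuous_ofReal.tendsto _).comp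
      ((Real.continuous_exp.tendsto _).comp (hs.neg.div_const 2))
  have h3 : Tendsto (fun n => (∫ ω, Complex.exp (r n * position (X n) (m n) ω * Complex.I) ∂P n) -
      (Real.exp (-((r n / weight (2 * p - 1) (m n)) ^ 2 *
        weightSq (2 * p - 1) (m n)) / 2) : ℂ)) atTop (𝓝 0) := by
    refine squeeze_zero_norm' ?_ h1
    filter_upwards [hm.eventually_ge_atTop 1] with n hn
    have := (hX n).norm_integral_exp_sub_le hp0 hp1 hn (hM n) (r n / weight (2 * p - 1) (m n))
    rwa [div_mul_cancel₀ _ (weight_pos ha _).ne'] at this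
  simpa using h3.add h2

/-! ### The steps after the memory has been frozen -/

lemma firstAndLastMemory_of_le {m k : ℕ} (hk : 1 ≤ k) (h : k ≤ m) :
    firstAndLastMemory m k = fullMemory k := by
  rw [firstAndLastMemory, fullMemory, min_eq_right h, Finset.union_eq_left,
    Finset.singleton_subset_iff]
  exact Finset.mem_Icc.2 ⟨hk, le_rfl⟩

lemma firstAndLastMemory_of_lt {m k : ℕ} (h : m < k) :
    firstAndLastMemory m k = insert k (Finset.Icc 1 m) := by
  rw [firstAndLastMemory, min_eq_left h.le, Finset.union_comm, Finset.insert_eq]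

/-- The difference between the position after `k` steps, when the first `m` steps and the last one
are remembered, and its approximate conditional expectation given the first `m` steps. -/
noncomputable def remainder (a : ℝ) (m k : ℕ) (x : ℕ → ℝ) : ℝ :=
  ∑ i ∈ Finset.Icc 1 k, x i - ∑ i ∈ Finset.Icc 1 m, x i -
    (k - m) * (a * (∑ i ∈ Finset.Icc 1 m, x i) / (m + 1 - a))

lemma remainder_self (a : ℝ) (m : ℕ) (x : ℕ → ℝ) : remainder a m m x = 0 := by
  simp [remainder]

lemma remainder_succ (a : ℝ) (m k : ℕ) (x : ℕ → ℝ) :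
    remainder a m (k + 1) x = remainder a m k x +
      (x (k + 1) - a * (∑ i ∈ Finset.Icc 1 m, x i) / (m + 1 - a)) := by
  simp only [remainder]
  rw [Finset.sum_Icc_succ_top (by omega)]
  push_cast
  ring

lemma dependsOn_remainder (a : ℝ) {m k : ℕ} (h : m ≤ k) :
    DependsOn (remainder a m k) (Set.Icc 1 k) := by
  intro x y hxy
  have h1 : ∑ i ∈ Finset.Icc 1 k, x i = ∑ i ∈ Finset.Icc 1 k, y i :=
    Finset.sum_congr rfl fun i hi => hxy i (Finset.mem_Icc.1 hi)
  have h2 : ∑ i ∈ Finset.Icc 1 m, x i = ∑ i ∈ Finset.Icc 1 m, y i :=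
    Finset.sum_congr rfl fun i hi =>
      hxy i ⟨(Finset.mem_Icc.1 hi).1, (Finset.mem_Icc.1 hi).2.trans h⟩
  simp only [remainder, h1, h2]

namespace IsElephantWalk

variable {Ω : Type*} [MeasurableSpace Ω] {P : Measure Ω} {p : ℝ} {m : ℕ}
  {X : ℕ → Ω → ℝ}

/-- Given the past, X_{k+1} has mean a(X_k + S_m)/(m + 1), a contraction in X_k with fixed point μ =
a S_m/(m + 1 - a). Hence X_{k+1} - μ has conditional mean a/(m + 1) times X_k - μ. For k > m the
last step is not among the first m, so the memory has m + 1 elements. -/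
lemma integral_remainder_mul_next [IsProbabilityMeasure P]
    (hX : IsElephantWalk P p (firstAndLastMemory m) X) (hp1 : p < 1) {k : ℕ}
    (hk : m < k) :
    ∫ ω, remainder (2 * p - 1) m k (fun i => X i ω) * (X (k + 1) ω -
      (2 * p - 1) * position X m ω / (m + 1 - (2 * p - 1))) ∂P =
    (2 * p - 1) / (m + 1) * ∫ ω, remainder (2 * p - 1) m k (fun i => X i ω) * (X k ω -
      (2 * p - 1) * position X m ω / (m + 1 - (2 * p - 1))) ∂P := by
  set a := 2 * p - 1 with ha
  have hden : (0 : ℝ) < m + 1 - a := by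
    have : (0 : ℝ) ≤ m := m.cast_nonneg
    linarith
  have hdep := dependsOn_remainder a hk.le
  have hpos : DependsOn (fun x : ℕ → ℝ => ∑ i ∈ Finset.Icc 1 m, x i) (Set.Icc 1 k) :=
    fun x y h => dependsOn_position id m fun i hi => h i ⟨hi.1, hi.2.trans hk.le⟩
  have h1 := hX.integral_next_smul (k := k) (by omega) (by
    rw [firstAndLastMemory_of_lt hk]
    refine Finset.insert_subset (Finset.mem_Icc.2 ⟨by omega, le_rfl⟩)
      (Finset.Icc_subset_Icc_right hk.le)) hdep
  have hcard : (firstAndLastMemory m k).card = m + 1 := by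
    rw [firstAndLastMemory_of_lt hk, Finset.card_insert_of_notMem (by simp [hk])]
    simp
  have hsum : ∀ ω, ∑ i ∈ firstAndLastMemory m k, X i ω = X k ω + position X m ω := fun ω => by
    rw [firstAndLastMemory_of_lt hk, Finset.sum_insert (by simp [hk]), position]
  simp only [hcard, hsum, smul_eq_mul] at h1
  have i1 : Integrable (fun ω => X (k + 1) ω * remainder a m k (fun i => X i ω)) P :=
    hX.integrable (g := fun x => x (k + 1) * remainder a m k x) (k := k + 1) fun x y h => by
      simp only [h (k + 1) ⟨by omega, le_rfl⟩,
        hdep fun i hi => h i ⟨hi.1, hi.2.trans (by omega)⟩]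
  have i2 : Integrable (fun ω => a * position X m ω / (m + 1 - a) *
      remainder a m k (fun i => X i ω)) P :=
    hX.integrable (g := fun x => a * (∑ i ∈ Finset.Icc 1 m, x i) / (m + 1 - a) *
      remainder a m k x) (k := k) fun x y h => by
        have := hpos h
        simp only at this
        simp only [this, hdep h]
  have i3 : Integrable (fun ω => a * ((X k ω + position X m ω) / ((m + 1 : ℕ) : ℝ)) *
      remainder a m k (fun i => X i ω)) P :=
    hX.integrable (g := fun x => a * ((x k + ∑ i ∈ Finset.Icc 1 m, x i) / ((m + 1 : ℕ) : ℝ)) *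
      remainder a m k x) (k := k) fun x y h => by
        have := hpos h
        simp only at this
        simp only [this, hdep h, h k ⟨by omega, le_rfl⟩]
  calc ∫ ω, remainder a m k (fun i => X i ω) * (X (k + 1) ω -
        a * position X m ω / (m + 1 - a)) ∂P
      = ∫ ω, (X (k + 1) ω * remainder a m k (fun i => X i ω) -
        a * position X m ω / (m + 1 - a) * remainder a m k (fun i => X i ω)) ∂P := by
        congr 1; ext ω; ring
    _ = ∫ ω, (a * ((X k ω + position X m ω) / ((m + 1 : ℕ) : ℝ)) *
        remainder a m k (fun i => X i ω) -
        a * position X m ω / (m + 1 - a) * remainder a m k (fun i => X i ω)) ∂P := by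
        rw [integral_sub i1 i2, h1, integral_sub i3 i2]
    _ = _ := by
        rw [← integral_const_mul]
        congr 1
        ext ω
        have : (m : ℝ) + 1 ≠ 0 := by positivity
        have := hden.ne'
        push_cast
        field_simp
        ring

/-- The remainder R_k is the sum of the centred steps Y_i = X_i - μ with m < i ≤ k. Its second
moment grows linearly once the correlations E[R_k Y_{k+1}] are bounded uniformly in k and m. -/
lemma integral_remainder_sq_le [IsProbabilityMeasure P]
    (hX : IsElephantWalk P p (firstAndLastMemory m) X) (hp0 : 0 < p) (hp1 : p < 1) (hm : 1 ≤ m)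
    {k : ℕ} (hk : m ≤ k) :
    ∫ ω, remainder (2 * p - 1) m k (fun i => X i ω) ^ 2 ∂P ≤ 12 * (k - m) := by
  set a := 2 * p - 1 with ha
  have hm1 : (1 : ℝ) ≤ m := by exact_mod_cast hm
  have hden : (0 : ℝ) < m + 1 - a := by linarith
  have ha1 : |a| ≤ 1 := abs_le.2 ⟨by linarith, by linarith⟩
  have hr : |a / (m + 1)| ≤ 1 / 2 := by
    rw [abs_div, abs_of_pos (by linarith : (0 : ℝ) < m + 1), div_le_iff₀ (by linarith)]
    linarith
  set Y : ℕ → Ω → ℝ := fun k ω => X k ω - a * position X m ω / (m + 1 - a) with hY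
  have hY2 : ∀ k, 1 ≤ k → ∫ ω, Y k ω ^ 2 ∂P ≤ 4 := by
    intro k hk
    have : (4 : ℝ) = ∫ _, (4 : ℝ) ∂P := by simp
    rw [this]
    refine integral_mono_of_nonneg (Eventually.of_forall fun ω => sq_nonneg _)
      (integrable_const _) ?_
    filter_upwards [hX.sign k hk, hX.ae_abs_position_le m] with ω h1 h2
    have h3 : |X k ω| ≤ 1 := by rcases h1 with h | h <;> rw [h] <;> simp
    have h4 : |a * position X m ω / (m + 1 - a)| ≤ 1 := by
      rw [abs_div, abs_mul, abs_of_pos hden, div_le_one hden]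
      calc |a| * |position X m ω| ≤ 1 * m := by gcongr
        _ ≤ _ := by linarith
    have h5 : |Y k ω| ≤ 2 := (abs_sub _ _).trans (by linarith)
    change Y k ω ^ 2 ≤ 4
    rw [← sq_abs]
    nlinarith [abs_nonneg (Y k ω)]
  have hint : ∀ k, m ≤ k → ∀ f : ℝ → ℝ → ℝ → ℝ, Integrable (fun ω =>
      f (remainder a m k (fun i => X i ω)) (position X m ω) (X (k + 1) ω)) P := by
    intro k hk f
    refine hX.integrable (g := fun x => f (remainder a m k x) (∑ i ∈ Finset.Icc 1 m, x i)
      (x (k + 1))) (k := k + 1) fun x y h => ?_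
    have h1 := dependsOn_position id m fun i hi => h i ⟨hi.1, hi.2.trans (by omega)⟩
    simp only [id] at h1
    simp only [h1, h (k + 1) ⟨by omega, le_rfl⟩,
      dependsOn_remainder a hk fun i hi => h i ⟨hi.1, hi.2.trans (by omega)⟩]
  have hstep : ∀ k, m ≤ k →
      ∫ ω, remainder a m (k + 1) (fun i => X i ω) ^ 2 ∂P ≤
        ∫ ω, remainder a m k (fun i => X i ω) ^ 2 ∂P +
        2 * ∫ ω, remainder a m k (fun i => X i ω) * Y (k + 1) ω ∂P + 4 ∧
      |∫ ω, remainder a m (k + 1) (fun i => X i ω) * Y (k + 1) ω ∂P| ≤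
        |∫ ω, remainder a m k (fun i => X i ω) * Y (k + 1) ω ∂P| + 4 := by
    intro k hk
    have i1 : Integrable (fun ω => remainder a m k (fun i => X i ω) ^ 2) P :=
      hint k hk fun u _ _ => u ^ 2
    have i2 : Integrable (fun ω => remainder a m k (fun i => X i ω) * Y (k + 1) ω) P :=
      hint k hk fun u v w => u * (w - a * v / (m + 1 - a))
    have i3 : Integrable (fun ω => Y (k + 1) ω ^ 2) P :=
      hint k hk fun u v w => (w - a * v / (m + 1 - a)) ^ 2
    have i4 : Integrable (fun ω => remainder a m k (fun i => X i ω) ^ 2 +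
        2 * (remainder a m k (fun i => X i ω) * Y (k + 1) ω)) P := i1.add (i2.const_mul 2)
    have hrem : ∀ ω, remainder a m (k + 1) (fun i => X i ω) =
        remainder a m k (fun i => X i ω) + Y (k + 1) ω := fun ω => remainder_succ a m k _
    have e1 : ∫ ω, remainder a m (k + 1) (fun i => X i ω) ^ 2 ∂P =
        ∫ ω, remainder a m k (fun i => X i ω) ^ 2 ∂P +
        2 * ∫ ω, remainder a m k (fun i => X i ω) * Y (k + 1) ω ∂P +
        ∫ ω, Y (k + 1) ω ^ 2 ∂P := by
      rw [← integral_const_mul, ← integral_add i1 (i2.const_mul 2), ← integral_add i4 i3]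
      congr 1
      ext ω
      rw [hrem]
      ring
    have e2 : ∫ ω, remainder a m (k + 1) (fun i => X i ω) * Y (k + 1) ω ∂P =
        ∫ ω, remainder a m k (fun i => X i ω) * Y (k + 1) ω ∂P +
        ∫ ω, Y (k + 1) ω ^ 2 ∂P := by
      rw [← integral_add i2 i3]
      congr 1
      ext ω
      rw [hrem]
      ring
    have h4 := hY2 (k + 1) (by omega)
    have h0 : 0 ≤ ∫ ω, Y (k + 1) ω ^ 2 ∂P := integral_nonneg fun _ => sq_nonneg _
    refine ⟨by rw [e1]; linarith, ?_⟩
    rw [e2]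
    refine (abs_add_le _ _).trans ?_
    rw [abs_of_nonneg h0]
    linarith
  -- The bound 8 reproduces itself: the factor a/(m + 1) halves it to 4, and E[Y²] ≤ 4 is added.
  -- Each increment of E[R²] is then at most 2 · 4 + 4 = 12. The induction starts at m + 1, since
  -- the damping needs k > m.
  have hmain : ∀ k, m + 1 ≤ k →
      ∫ ω, remainder a m k (fun i => X i ω) ^ 2 ∂P ≤ 12 * (k - m) ∧
      |∫ ω, remainder a m k (fun i => X i ω) * Y k ω ∂P| ≤ 8 := by
    intro k hk
    induction k, hk using Nat.le_induction with
    | base =>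
      obtain ⟨h1, h2⟩ := hstep m le_rfl
      simp only [remainder_self] at h1 h2
      norm_num at h1 h2
      refine ⟨?_, by linarith⟩
      push_cast
      linarith
    | succ k hk ih =>
      obtain ⟨h1, h2⟩ := hstep k (by omega)
      have h3 : |∫ ω, remainder a m k (fun i => X i ω) * Y (k + 1) ω ∂P| ≤ 4 := by
        rw [show (∫ ω, remainder a m k (fun i => X i ω) * Y (k + 1) ω ∂P) = _ from
          hX.integral_remainder_mul_next hp1 (by omega), abs_mul]
        calc _ ≤ 1 / 2 * 8 := mul_le_mul hr ih.2 (abs_nonneg _) (by norm_num)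
          _ = 4 := by norm_num
      refine ⟨?_, by linarith⟩
      have := le_abs_self (∫ ω, remainder a m k (fun i => X i ω) * Y (k + 1) ω ∂P)
      push_cast
      linarith [ih.1]
  rcases hk.eq_or_lt with rfl | hk
  · simp [remainder_self]
  · exact (hmain k hk).1

/-- The two positions differ by the remainder R, and |exp(ix) - 1| ≤ |x|. The first moment of |R| is
bounded through 2|R| ≤ R²/q + q with q = √(12n). -/
lemma norm_integral_exp_sub_integral_exp_le [IsProbabilityMeasure P]
    (hX : IsElephantWalk P p (firstAndLastMemory m) X) (hp0 : 0 < p) (hp1 : p < 1) (hm : 1 ≤ m)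
    {n : ℕ} (hn : m ≤ n) (r : ℝ) :
    ‖∫ ω, Complex.exp (r * position X n ω * Complex.I) ∂P -
      ∫ ω, Complex.exp ((r * (1 + (n - m) * (2 * p - 1) / (m + 1 - (2 * p - 1))) : ℝ) *
        position X m ω * Complex.I) ∂P‖ ≤ |r| * √(12 * n) := by
  set a := 2 * p - 1 with ha
  have hn0 : (0 : ℝ) < n := by exact_mod_cast hm.trans hn
  set q := √(12 * (n : ℝ)) with hq
  have hq0 : 0 < q := Real.sqrt_pos.2 (by positivity)
  have hqq : q ^ 2 = 12 * n := Real.sq_sqrt (by positivity)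
  have hR : ∀ ω, remainder a m n (fun i => X i ω) = position X n ω -
      (1 + (n - m) * a / (m + 1 - a)) * position X m ω := fun ω => by
    simp only [remainder, position]
    ring
  have i0 : Integrable (fun ω => remainder a m n (fun i => X i ω) ^ 2) P :=
    hX.integrable (g := fun x => remainder a m n x ^ 2) (k := n) fun x y h => by
      simp only [dependsOn_remainder a hn h]
  rw [← integral_sub (hX.integrable_position (fun t => Complex.exp (r * t * Complex.I)) n)
    (hX.integrable_position (fun t => Complex.exp ((r * (1 + (n - m) * a / (m + 1 - a)) : ℝ) *
      t * Complex.I)) m)]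
  have hbound : ∫ ω, |r| * ((remainder a m n (fun i => X i ω) ^ 2 / q + q) / 2) ∂P ≤ |r| * q := by
    rw [integral_const_mul]
    gcongr
    rw [integral_div, integral_add (i0.div_const q) (integrable_const _), integral_div]
    have h1 := hX.integral_remainder_sq_le hp0 hp1 hm hn
    have h2 : (∫ ω, remainder a m n (fun i => X i ω) ^ 2 ∂P) / q ≤ q := by
      rw [div_le_iff₀ hq0, ← sq, hqq]
      have : (0 : ℝ) ≤ m := m.cast_nonneg
      linarith
    simp
    linarith
  refine (norm_integral_le_of_norm_le (((i0.div_const q).add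
    (integrable_const q)).div_const 2 |>.const_mul |r|) (Eventually.of_forall fun ω => ?_)).trans
    hbound
  have e : Complex.exp (r * position X n ω * Complex.I) =
      Complex.exp ((r * (1 + (n - m) * a / (m + 1 - a)) : ℝ) * position X m ω * Complex.I) *
      Complex.exp (Complex.I * ((r * remainder a m n (fun i => X i ω) : ℝ) : ℂ)) := by
    rw [← Complex.exp_add, hR]
    congr 1
    push_cast
    ring
  change _ ≤ |r| * ((remainder a m n (fun i => X i ω) ^ 2 / q + q) / 2)
  rw [e, ← mul_sub_one, norm_mul, ← Complex.ofReal_mul, Complex.norm_exp_ofReal_mul_I, one_mul]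
  refine Real.norm_exp_I_mul_ofReal_sub_one_le.trans ?_
  rw [Real.norm_eq_abs, abs_mul]
  gcongr
  set z := remainder a m n (fun i => X i ω)
  have : 2 * |z| * q ≤ z ^ 2 + q ^ 2 := by nlinarith [sq_nonneg (|z| - q), sq_abs z]
  rw [le_div_iff₀ two_pos, div_add' _ _ _ hq0.ne', le_div_iff₀ hq0]
  linarith

end IsElephantWalk

/-! ### Almost sure convergence in the superdiffusive case -/

/-- The path with the steps of `x` up to `k`, continued by `1`. -/
def truncatePath (k : ℕ) (x : ℕ → ℝ) (i : ℕ) : ℝ := if i ∈ Finset.Icc 1 k then x i else 1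

lemma measurable_truncatePath (k : ℕ) : Measurable (truncatePath k) := by
  refine measurable_pi_lambda _ fun i => ?_
  unfold truncatePath
  split_ifs
  · exact measurable_pi_apply i
  · exact measurable_const

lemma truncatePath_truncatePath {k l : ℕ} (h : k ≤ l) (x : ℕ → ℝ) :
    truncatePath k (truncatePath l x) = truncatePath k x := by
  ext i
  unfold truncatePath
  split_ifs with h1 h2
  · rfl
  · exact absurd (Finset.Icc_subset_Icc_right h h1) h2
  · rfl

lemma dependsOn_truncatePath (k : ℕ) : DependsOn (truncatePath k) (Set.Icc 1 k) := by
  intro x y h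
  ext i
  unfold truncatePath
  split_ifs with hi
  · exact h i (Finset.mem_Icc.1 hi)
  · rfl

namespace IsElephantWalk

variable {Ω : Type*} [mΩ : MeasurableSpace Ω] {P : Measure Ω} {p : ℝ} {M : ℕ → Finset ℕ}
  {X : ℕ → Ω → ℝ}

/-- Truncation discards `X 0`, which is not assumed to be measurable. -/
lemma measurable_truncatePath_comp (hX : IsElephantWalk P p M X) (k : ℕ) :
    Measurable fun ω => truncatePath k fun i => X i ω := by
  refine measurable_pi_lambda _ fun i => ?_
  unfold truncatePath
  split_ifs with h
  · exact hX.measurable i (Finset.mem_Icc.1 h).1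
  · exact measurable_const

/-- The filtration that is generated by the steps, starting with the first one. -/
def filtration (hX : IsElephantWalk P p M X) : Filtration ℕ mΩ where
  seq k := MeasurableSpace.comap (fun ω => truncatePath (k + 1) fun i => X i ω) inferInstance
  mono' k l hkl := by
    have : (fun ω => truncatePath (k + 1) fun i => X i ω) =
        truncatePath (k + 1) ∘ fun ω => truncatePath (l + 1) fun i => X i ω := by
      ext1 ω
      exact (truncatePath_truncatePath (by omega) _).symm
    dsimp only
    rw [this, ← MeasurableSpace.comap_comp]
    exact MeasurableSpace.comap_mono (measurable_truncatePath (k + 1)).comap_le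
  le' k := (hX.measurable_truncatePath_comp (k + 1)).comap_le

/-- Time is shifted by one: the process starts with the first step, to which the recursion for
conditional means does not apply. -/
lemma martingale_weight_mul_position [IsProbabilityMeasure P]
    (hX : IsElephantWalk P p fullMemory X) (hp0 : 0 < p) :
    Martingale (fun k ω => weight (2 * p - 1) (k + 1) * position X (k + 1) ω) hX.filtration P := by
  have ha : -1 < 2 * p - 1 := by linarith
  refine martingale_of_setIntegral_eq_succ (fun k => ?_)
    (fun k => hX.integrable_position (fun t => weight (2 * p - 1) (k + 1) * t) (k + 1)) ?_
  · refine Measurable.stronglyMeasurable ?_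
    have h1 : Measurable fun x : ℕ → ℝ =>
        weight (2 * p - 1) (k + 1) * ∑ i ∈ Finset.Icc 1 (k + 1), x i :=
      (Finset.measurable_sum _ fun i _ => measurable_pi_apply i).const_mul _
    have h2 := h1.comp (comap_measurable (fun ω => truncatePath (k + 1) fun i => X i ω))
    convert! h2 using 1
    ext ω
    simp only [Function.comp_apply, position]
    congr 1
    exact Finset.sum_congr rfl fun i hi => by simp only [truncatePath, hi, if_true]
  · rintro k s ⟨B, hB, rfl⟩
    have hs := hX.measurable_truncatePath_comp (k + 1) hB
    rw [← integral_indicator hs, ← integral_indicator hs]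
    set a := 2 * p - 1
    set c := weight a (k + 2) with hc
    have hw : weight a (k + 1) = c * (1 + a / ((k + 1 : ℕ) : ℝ)) := (weight_succ_mul ha _).symm
    set g : (ℕ → ℝ) → ℝ := fun x => B.indicator (fun _ => c) (truncatePath (k + 1) x) with hg
    have hgd : DependsOn g (Set.Icc 1 (k + 1)) := fun x y h => by
      simp only [hg, dependsOn_truncatePath (k + 1) h]
    have h1 := hX.integral_next_smul_position (k := k + 1) (by omega) rfl hgd
    have hpd : DependsOn (fun x => (∑ i ∈ Finset.Icc 1 (k + 1), x i) * g x)
        (Set.Icc 1 (k + 1)) := fun x y h => by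
      have := dependsOn_position id (k + 1) h
      simp only [id] at this
      simp only [this, hgd h]
    have i1 : Integrable (fun ω => position X (k + 1) ω * g (fun i => X i ω)) P :=
      hX.integrable hpd
    have i2 : Integrable (fun ω => X (k + 2) ω • g (fun i => X i ω)) P :=
      hX.integrable (g := fun x => x (k + 2) • g x) (k := k + 2) fun x y h => by
        simp only [h (k + 2) ⟨by omega, le_rfl⟩,
          hgd fun i hi => h i ⟨hi.1, hi.2.trans (by omega)⟩]
    have i3 : Integrable (fun ω => (a * (position X (k + 1) ω / ((k + 1 : ℕ) : ℝ))) •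
        g (fun i => X i ω)) P := by
      refine (i1.const_mul (a / ((k + 1 : ℕ) : ℝ))).congr (Eventually.of_forall fun ω => ?_)
      simp only [smul_eq_mul]
      ring
    calc _ = ∫ ω, (position X (k + 1) ω * g (fun i => X i ω) +
          (a * (position X (k + 1) ω / ((k + 1 : ℕ) : ℝ))) • g (fun i => X i ω)) ∂P := by
          congr 1
          ext ω
          by_cases h : (truncatePath (k + 1) fun i => X i ω) ∈ B
          · rw [Set.indicator_of_mem (show ω ∈ _ from h)]
            simp only [hg, Set.indicator_of_mem h, hw, smul_eq_mul]
            ring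
          · rw [Set.indicator_of_notMem (show ω ∉ _ from h)]
            simp only [hg, Set.indicator_of_notMem h, smul_zero, mul_zero, add_zero]
      _ = ∫ ω, (position X (k + 1) ω * g (fun i => X i ω) + X (k + 2) ω • g (fun i => X i ω)) ∂P := by
          rw [integral_add i1 i3, ← h1, integral_add i1 i2]
      _ = _ := by
          congr 1
          ext ω
          by_cases h : (truncatePath (k + 1) fun i => X i ω) ∈ B
          · rw [Set.indicator_of_mem (show ω ∈ _ from h), position_succ X (k + 1)]
            simp only [hg, Set.indicator_of_mem h, smul_eq_mul]
            ring
          · rw [Set.indicator_of_notMem (show ω ∉ _ from h)]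
            simp only [hg, Set.indicator_of_notMem h, smul_zero, mul_zero, add_zero]

/-- The superdiffusive elephant random walk with full memory, suitably normalized, converges almost
surely. -/
lemma exists_tendsto_position_div_rpow [IsProbabilityMeasure P]
    (hX : IsElephantWalk P p fullMemory X) (hp : 3 / 4 < p) :
    ∃ L : Ω → ℝ, Measurable L ∧ ∀ᵐ ω ∂P,
      Tendsto (fun k : ℕ => position X k ω / (k : ℝ) ^ (2 * p - 1)) atTop (𝓝 (L ω)) := by
  have ha : -1 < 2 * p - 1 := by linarith
  have hG : 0 < Real.Gamma (1 + (2 * p - 1)) := Real.Gamma_pos_of_pos (by linarith)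
  have hmart := hX.martingale_weight_mul_position (by linarith)
  set f : ℕ → Ω → ℝ := fun k ω => weight (2 * p - 1) (k + 1) * position X (k + 1) ω with hf
  set C := 2 * (2 * p - 1) / (2 * (2 * p - 1) - 1) with hC
  -- The second moments are at most C by `weightSq_le_of_lt`, and |f| ≤ 1 + f² turns this into the
  -- L¹ bound of Doob's theorem.
  have hbdd : ∀ n, eLpNorm (f n) 1 P ≤ ((1 + C).toNNReal : ENNReal) := by
    intro n
    have hint : Integrable (f n) P := hmart.integrable n
    have hint2 : Integrable (fun ω => f n ω ^ 2) P :=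
      hX.integrable_position (fun t => (weight (2 * p - 1) (n + 1) * t) ^ 2) (n + 1)
    have h2 : ∫ ω, f n ω ^ 2 ∂P ≤ C := by
      have := hX.weight_sq_mul_integral_position_sq_le (by linarith) (n := n + 1)
        (fun _ _ _ => rfl) le_rfl
      rw [← integral_const_mul] at this
      simp only [hf, mul_pow]
      exact this.trans (weightSq_le_of_lt (by linarith) _)
    have h3 : ∫ ω, ‖f n ω‖ ∂P ≤ 1 + C := by
      calc ∫ ω, ‖f n ω‖ ∂P ≤ ∫ ω, (1 + f n ω ^ 2) ∂P := by
            refine integral_mono hint.norm ((integrable_const _).add hint2) fun ω => ?_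
            change |f n ω| ≤ 1 + f n ω ^ 2
            rw [← sq_abs]
            nlinarith [sq_nonneg (|f n ω| - 1), abs_nonneg (f n ω)]
        _ = 1 + ∫ ω, f n ω ^ 2 ∂P := by
            rw [integral_add (integrable_const _) hint2]
            simp
        _ ≤ _ := by linarith
    rw [eLpNorm_one_eq_lintegral_enorm, ← ofReal_integral_norm_eq_lintegral_enorm hint]
    exact ENNReal.ofReal_le_ofReal h3
  have hlim := hmart.submartingale.ae_tendsto_limitProcess hbdd
  -- The martingale limit is divided by Γ(1 + a), because c_k k^a tends to this constant.
  refine ⟨fun ω => hX.filtration.limitProcess f P ω / Real.Gamma (1 + (2 * p - 1)), ?_, ?_⟩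
  · exact ((Filtration.stronglyMeasurable_limitProcess.mono (iSup_le hX.filtration.le)).measurable).div_const _
  · filter_upwards [hlim] with ω hω
    have h1 := (tendsto_add_atTop_iff_nat
      (f := fun k => weight (2 * p - 1) k * position X k ω) 1).1 hω
    refine (h1.div (tendsto_weight_mul_rpow ha) hG.ne').congr fun n => ?_
    have := (weight_pos ha n).ne'
    simp only [Pi.div_apply]
    rw [mul_div_mul_left _ _ this]

end IsElephantWalk

/-! ### Passage to the limit in distribution -/

lemma tendstoInDistribution_of_tendsto_integral_exp {Ω : ℕ → Type*} [∀ n, MeasurableSpace (Ω n)]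
    {P : ∀ n, Measure (Ω n)} [∀ n, IsProbabilityMeasure (P n)] {Y : ∀ n, Ω n → ℝ}
    (hY : ∀ n, AEMeasurable (Y n) (P n))
    {Ω' : Type*} [MeasurableSpace Ω'] {P' : Measure Ω'} [IsProbabilityMeasure P'] {Z : Ω' → ℝ}
    (hZ : AEMeasurable Z P')
    (h : ∀ t : ℝ, Tendsto (fun n => ∫ ω, Complex.exp (t * Y n ω * Complex.I) ∂P n) atTop
      (𝓝 (∫ ω, Complex.exp (t * Z ω * Complex.I) ∂P'))) :
    TendstoInDistribution Y atTop Z P P' := by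
  refine ⟨hY, hZ, ProbabilityMeasure.tendsto_iff_tendsto_charFun.2 fun t => ?_⟩
  simp only [ProbabilityMeasure.coe_mk]
  have h1 : charFun (P'.map Z) t = ∫ ω, Complex.exp (t * Z ω * Complex.I) ∂P' := by
    rw [charFun_apply_real, integral_map hZ (by fun_prop)]
  have h2 : ∀ n, charFun ((P n).map (Y n)) t =
      ∫ ω, Complex.exp (t * Y n ω * Complex.I) ∂P n := fun n => by
    rw [charFun_apply_real, integral_map (hY n) (by fun_prop)]
  simp only [h1, h2]
  exact h t

lemma eventually_le_of_tendsto_div {m : ℕ → ℕ}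
    (hmn : Tendsto (fun n => (m n : ℝ) / (n : ℝ)) atTop (𝓝 0)) : ∀ᶠ n in atTop, m n ≤ n := by
  filter_upwards [hmn.eventually_le_const one_pos, eventually_gt_atTop 0] with n h1 h2
  have h3 : (0 : ℝ) < n := by exact_mod_cast h2
  rw [div_le_one h3] at h1
  exact_mod_cast h1

/-- The ratio of the conditional expectation of the position after `n` steps, given the first `m`
steps, and of `n / m` times the position after `m` steps. -/
noncomputable def memoryRatio (a : ℝ) (m n : ℕ) : ℝ :=
  m / n * (1 + (n - m) * a / (m + 1 - a))

lemma tendsto_memoryRatio (a : ℝ) {m : ℕ → ℕ} (hm : Tendsto m atTop atTop)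
    (hmn : Tendsto (fun n => (m n : ℝ) / (n : ℝ)) atTop (𝓝 0)) :
    Tendsto (fun n => memoryRatio a (m n) n) atTop (𝓝 a) := by
  have hm' : Tendsto (fun n => (m n : ℝ)) atTop atTop := tendsto_natCast_atTop_atTop.comp hm
  have h1 : Tendsto (fun n => 1 + (1 - a) / (m n : ℝ)) atTop (𝓝 1) := by
    simpa using (hm'.const_div_atTop (1 - a)).const_add 1
  -- For large n the ratio equals m/n + (1 - m/n) a / (1 + (1 - a)/m).
  have h2 := hmn.add (((hmn.const_sub 1).mul_const a).div h1 one_ne_zero)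
  simp only [sub_zero, one_mul, div_one, zero_add] at h2
  refine h2.congr' ?_
  filter_upwards [hm'.eventually_gt_atTop 0, hm'.eventually_gt_atTop (a - 1),
    eventually_gt_atTop 0] with n h3 h4 h5
  have h6 : (n : ℝ) ≠ 0 := by positivity
  have h7 : (m n : ℝ) + 1 - a ≠ 0 := by linarith
  have h8 : 1 + (1 - a) / (m n : ℝ) = (m n + 1 - a) / m n := by field_simp; ring
  simp only [Pi.div_apply]
  rw [memoryRatio, h8]
  field_simp

section

variable {p : ℝ} {m : ℕ → ℕ} {Ω : ℕ → Type*} [∀ n, MeasurableSpace (Ω n)]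
  {P : ∀ n, Measure (Ω n)} [∀ n, IsProbabilityMeasure (P n)] {X : ∀ n, ℕ → Ω n → ℝ}

/-- The limit law of the position of the elephant who remembers the first `m n` steps and the last
one is determined by the position after `m n` steps. -/
lemma tendstoInDistribution_position (hp0 : 0 < p) (hp1 : p < 1) (hm : Tendsto m atTop atTop)
    (hmn : Tendsto (fun n => (m n : ℝ) / (n : ℝ)) atTop (𝓝 0))
    (hX : ∀ n, IsElephantWalk (P n) p (firstAndLastMemory (m n)) (X n)) {b : ℕ → ℝ}
    (hb : ∀ᶠ n in atTop, b n ^ 2 ≤ m n)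
    {Ω' : Type*} [MeasurableSpace Ω'] {P' : Measure Ω'} [IsProbabilityMeasure P'] {Z : Ω' → ℝ}
    (hZ : AEMeasurable Z P')
    (h : ∀ t : ℝ, Tendsto (fun n => ∫ ω, Complex.exp
      ((t * memoryRatio (2 * p - 1) (m n) n * (b n / m n) : ℝ) * position (X n) (m n) ω *
        Complex.I) ∂P n) atTop (𝓝 (∫ ω, Complex.exp (t * Z ω * Complex.I) ∂P'))) :
    TendstoInDistribution (fun n ω => position (X n) n ω * b n / (n : ℝ)) atTop Z P P' := by
  refine tendstoInDistribution_of_tendsto_integral_exp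
    (fun n => (((hX n).measurable_position n).mul_const _ |>.div_const _).aemeasurable) hZ
    fun t => ?_
  -- The error at frequency t b/n is |t b/n| √(12n), and b² ≤ m bounds it by |t| √(12 m/n).
  have hbound : Tendsto (fun n => |t| * √(12 * ((m n : ℝ) / n))) atTop (𝓝 0) := by
    simpa using (hmn.const_mul 12).sqrt.const_mul |t|
  have hdiff : Tendsto (fun n =>
      ∫ ω, Complex.exp (t * (position (X n) n ω * b n / n : ℝ) * Complex.I) ∂P n -
      ∫ ω, Complex.exp ((t * memoryRatio (2 * p - 1) (m n) n * (b n / m n) : ℝ) *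
        position (X n) (m n) ω * Complex.I) ∂P n) atTop (𝓝 0) := by
    refine squeeze_zero_norm' ?_ hbound
    filter_upwards [hb, eventually_le_of_tendsto_div hmn, hm.eventually_ge_atTop 1]
      with n h1 h2 h3
    have hm0 : (0 : ℝ) < m n := by exact_mod_cast h3
    have hn0 : (0 : ℝ) < n := by exact_mod_cast h3.trans h2
    have h4 := (hX n).norm_integral_exp_sub_integral_exp_le hp0 hp1 h3 h2 (t * b n / n)
    have e1 : t * memoryRatio (2 * p - 1) (m n) n * (b n / m n) = t * b n / n *
        (1 + (n - m n) * (2 * p - 1) / (m n + 1 - (2 * p - 1))) := by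
      rw [memoryRatio]
      field_simp
    have e2 : ∀ ω, (t : ℂ) * (position (X n) n ω * b n / n : ℝ) =
        (t * b n / n : ℝ) * position (X n) n ω := fun ω => by
      push_cast
      ring
    simp only [e1, e2]
    refine h4.trans ?_
    rw [abs_div, abs_mul, abs_of_pos hn0, mul_div_assoc, mul_assoc]
    gcongr
    refine Real.le_sqrt_of_sq_le ?_
    rw [mul_pow, div_pow, sq_abs, Real.sq_sqrt (by positivity)]
    calc b n ^ 2 / (n : ℝ) ^ 2 * (12 * n) ≤ m n / (n : ℝ) ^ 2 * (12 * n) := by gcongr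
      _ = _ := by field_simp
  simpa using hdiff.add (h t)

/-- The diffusive and the critical case share one proof: ℓ is 1 or the logarithm, and V_k ~ σ k c_k²
ℓ_k. The two error conditions of the central limit theorem follow, as c_k²/V_k is of order 1/(k ℓ_k)
and V_k/(c_k² k²) of order ℓ_k/k. -/
lemma tendstoInDistribution_position_gaussian (hp0 : 0 < p) (hp1 : p < 1)
    (hm : Tendsto m atTop atTop)
    (hmn : Tendsto (fun n => (m n : ℝ) / (n : ℝ)) atTop (𝓝 0))
    (hX : ∀ n, IsElephantWalk (P n) p (firstAndLastMemory (m n)) (X n))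
    (hv : Tendsto (weightSq (2 * p - 1)) atTop atTop) {ℓ : ℕ → ℝ}
    (hl1 : ∀ᶠ k in atTop, 1 ≤ ℓ k) (hl2 : Tendsto (fun k => ℓ k / k) atTop (𝓝 0))
    {σ : ℝ} (hσ : 0 < σ)
    (hw : Tendsto (fun k : ℕ => weightSq (2 * p - 1) k / (k * weight (2 * p - 1) k ^ 2 * ℓ k))
      atTop (𝓝 σ)) :
    TendstoInDistribution (fun n ω => position (X n) n ω * √((m n : ℝ) / ℓ (m n)) / (n : ℝ)) atTop
      id P (gaussianReal 0 ((2 * p - 1) ^ 2 * σ).toNNReal) := by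
  have ha : -1 < 2 * p - 1 := by linarith
  have hc : Tendsto (fun n => weight (2 * p - 1) n ^ 2 / weightSq (2 * p - 1) n) atTop (𝓝 0) := by
    have h1 := (hw.inv₀ hσ.ne').mul tendsto_one_div_atTop_nhds_zero_nat
    rw [mul_zero] at h1
    refine squeeze_zero' (Eventually.of_forall fun n => ?_) ?_ h1
    · have := weightSq_nonneg (2 * p - 1) n
      positivity
    · filter_upwards [hl1, eventually_gt_atTop 0] with n h2 h3
      have h4 := weightSq_nonneg (2 * p - 1) n
      have h5 : (n : ℝ) ≠ 0 := by positivity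
      rw [inv_div, div_mul_div_comm, mul_one, mul_assoc, mul_comm (n : ℝ),
        mul_div_mul_right _ _ h5]
      gcongr
      exact le_mul_of_one_le_right (sq_nonneg _) h2
  have he : Tendsto (fun n : ℕ => weightSq (2 * p - 1) n / (weight (2 * p - 1) n ^ 2 * n ^ 2))
      atTop (𝓝 0) := by
    have h1 := hw.mul hl2
    rw [mul_zero] at h1
    refine h1.congr' ?_
    filter_upwards [hl1] with n h2
    have h3 : ℓ n ≠ 0 := by linarith
    field_simp
  refine tendstoInDistribution_position hp0 hp1 hm hmn hX ?_ aemeasurable_id fun t => ?_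
  · filter_upwards [hm.eventually hl1] with n hn
    rw [Real.sq_sqrt (by positivity)]
    exact div_le_self (Nat.cast_nonneg _) hn
  · have hr : Tendsto (fun n => (t * memoryRatio (2 * p - 1) (m n) n *
        (√((m n : ℝ) / ℓ (m n)) / m n)) ^ 2 *
        (weightSq (2 * p - 1) (m n) / weight (2 * p - 1) (m n) ^ 2)) atTop
        (𝓝 ((t * (2 * p - 1)) ^ 2 * σ)) := by
      refine ((((tendsto_memoryRatio (2 * p - 1) hm hmn).const_mul t).pow 2).mul
        (hw.comp hm)).congr' ?_
      filter_upwards [hm.eventually hl1, hm.eventually_gt_atTop 0] with n h1 h2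
      have h3 : ℓ (m n) ≠ 0 := by linarith
      have h4 : (m n : ℝ) ≠ 0 := by positivity
      simp only [Function.comp_apply]
      rw [mul_pow _ (_ / _ : ℝ), div_pow, Real.sq_sqrt (by positivity)]
      field_simp
    have h1 := tendsto_integral_exp_position hp0 hp1 hv hc he hm hX
      (fun n k hk hkm => firstAndLastMemory_of_le hk hkm.le) hr
    have h2 : ∫ x, Complex.exp (t * id x * Complex.I)
        ∂(gaussianReal 0 ((2 * p - 1) ^ 2 * σ).toNNReal) =
        (Real.exp (-((t * (2 * p - 1)) ^ 2 * σ) / 2) : ℂ) := by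
      have := charFun_gaussianReal (μ := 0) (v := ((2 * p - 1) ^ 2 * σ).toNNReal) t
      rw [charFun_apply_real] at this
      simp only [id]
      rw [this, Complex.ofReal_exp]
      congr 1
      have hco : ((((2 * p - 1) ^ 2 * σ).toNNReal : ℝ) : ℂ) = (((2 * p - 1) ^ 2 * σ : ℝ) : ℂ) := by
        rw [Real.coe_toNNReal _ (by positivity)]
      rw [hco]
      push_cast
      ring
    rw [h2]
    exact h1

end

/-! ### The three regimes -/

theorem mainTheorem7 (p : ℝ) (hp0 : 0 < p) (hp1 : p < 1)
    (m : ℕ → ℕ) (hm : Tendsto m atTop atTop)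
    (hmn : Tendsto (fun n => (m n : ℝ) / (n : ℝ)) atTop (𝓝 0))
    {Ω : ℕ → Type*} [∀ n, MeasurableSpace (Ω n)] (P : ∀ n, Measure (Ω n))
    [∀ n, IsProbabilityMeasure (P n)] (X : ∀ n, ℕ → Ω n → ℝ)
    (hX : ∀ n, IsElephantWalk (P n) p (firstAndLastMemory (m n)) (X n)) :
    (p < 3 / 4 →
      TendstoInDistribution
        (fun n ω => position (X n) n ω * √(m n : ℝ) / (n : ℝ)) atTop
        id P (gaussianReal 0 ((2 * p - 1) ^ 2 / (3 - 4 * p)).toNNReal)) ∧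
    (p = 3 / 4 →
      TendstoInDistribution
        (fun n ω => position (X n) n ω * √((m n : ℝ) / Real.log (m n : ℝ)) / (n : ℝ)) atTop
        id P (gaussianReal 0 (1 / 4))) ∧
    (3 / 4 < p →
      ∀ {Ω' : Type*} [MeasurableSpace Ω'] (P' : Measure Ω') [IsProbabilityMeasure P']
        (W : ℕ → Ω' → ℝ), IsElephantWalk P' p fullMemory W →
        ∃ L : Ω' → ℝ, Measurable L ∧
          (∀ᵐ ω ∂P', Tendsto (fun k : ℕ => position W k ω / (k : ℝ) ^ (2 * p - 1)) atTop
            (𝓝 (L ω))) ∧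
          TendstoInDistribution
            (fun n ω => position (X n) n ω * (m n : ℝ) ^ (2 * (1 - p)) / (n : ℝ)) atTop
            (fun ω => (2 * p - 1) * L ω) P P') := by
  refine ⟨fun hp => ?_, fun hp => ?_, fun hp Ω' _ P' _ W hW => ?_⟩
  · have hw := tendsto_weightSq_div_of_lt (a := 2 * p - 1) (by linarith) (by linarith)
    have h := tendstoInDistribution_position_gaussian hp0 hp1 hm hmn hX
      (tendsto_weightSq_atTop_of_lt (by linarith) (by linarith)) (ℓ := fun _ => 1)
      (Eventually.of_forall fun _ => le_rfl) tendsto_one_div_atTop_nhds_zero_nat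
      (σ := 1 / (1 - 2 * (2 * p - 1))) (one_div_pos.2 (by linarith)) (by simpa using hw)
    rw [mul_one_div, show 1 - 2 * (2 * p - 1) = 3 - 4 * p by ring] at h
    simpa using h
  · have ha : 2 * p - 1 = 1 / 2 := by rw [hp]; norm_num
    have hl2 : Tendsto (fun k : ℕ => Real.log k / k) atTop (𝓝 0) :=
      (Real.isLittleO_log_id_atTop.tendsto_div_nhds_zero).comp tendsto_natCast_atTop_atTop
    have h := tendstoInDistribution_position_gaussian hp0 hp1 hm hmn hX
      (by rw [ha]; exact tendsto_weightSq_half_atTop) (ℓ := fun k => Real.log k)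
      ((Real.tendsto_log_atTop.comp tendsto_natCast_atTop_atTop).eventually_ge_atTop 1) hl2
      one_pos (by rw [ha]; exact tendsto_weightSq_half_div)
    have hv : ((2 * p - 1) ^ 2 * 1).toNNReal = 1 / 4 := by
      rw [ha]
      ext
      rw [Real.coe_toNNReal _ (by norm_num)]
      norm_num
    rwa [hv] at h
  · obtain ⟨L, hL, hlim⟩ := hW.exists_tendsto_position_div_rpow hp
    refine ⟨L, hL, hlim, tendstoInDistribution_position hp0 hp1 hm hmn hX ?_
      (hL.const_mul _).aemeasurable fun t => ?_⟩
    -- Here b² = m^{4(1 - p)}, and 4(1 - p) < 1 because p > 3/4.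
    · filter_upwards [hm.eventually_ge_atTop 1] with n hn
      have hn' : (1 : ℝ) ≤ m n := by exact_mod_cast hn
      rw [← Real.rpow_natCast, ← Real.rpow_mul (by linarith)]
      calc (m n : ℝ) ^ (2 * (1 - p) * (2 : ℕ)) ≤ (m n : ℝ) ^ (1 : ℝ) :=
            Real.rpow_le_rpow_of_exponent_le hn' (by push_cast; linarith)
        _ = m n := Real.rpow_one _
    · set r : ℕ → ℝ := fun n => t * memoryRatio (2 * p - 1) (m n) n *
        ((m n : ℝ) ^ (2 * (1 - p)) / m n) with hr
      -- Up to time m both memories are full, so the single walk W can replace all the walks X n;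
      -- almost sure convergence on its probability space then becomes available.
      have hlaw : ∀ n, ∫ ω, Complex.exp (r n * position (X n) (m n) ω * Complex.I) ∂P n =
          ∫ ω, Complex.exp (r n * position W (m n) ω * Complex.I) ∂P' := fun n =>
        (hX n).integral_eq_integral hW
          (fun k hk hkm => firstAndLastMemory_of_le hk hkm.le)
          (dependsOn_position (fun x => Complex.exp (r n * x * Complex.I)) (m n))
      refine Tendsto.congr (fun n => (hlaw n).symm) ?_
      refine tendsto_integral_of_dominated_convergence (fun _ => 1) (fun n => ?_)
        (integrable_const _) (fun n => Eventually.of_forall fun ω => ?_) ?_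
      · exact (hW.integrable_position (fun x => Complex.exp (r n * x * Complex.I))
          (m n)).aestronglyMeasurable
      · rw [← Complex.ofReal_mul, Complex.norm_exp_ofReal_mul_I]
      · filter_upwards [hlim] with ω hω
        have h1 : Tendsto (fun n => r n * position W (m n) ω) atTop
            (𝓝 (t * ((2 * p - 1) * L ω))) := by
          have h2 := ((tendsto_memoryRatio (2 * p - 1) hm hmn).const_mul t).mul (hω.comp hm)
          rw [mul_assoc] at h2
          refine h2.congr' ?_
          filter_upwards [hm.eventually_gt_atTop 0] with n hn
          have hn' : (0 : ℝ) < m n := by exact_mod_cast hn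
          have e : (m n : ℝ) ^ (2 * (1 - p)) / m n = ((m n : ℝ) ^ (2 * p - 1))⁻¹ := by
            rw [← Real.rpow_neg hn'.le, div_eq_mul_inv, ← Real.rpow_neg_one (m n : ℝ),
              ← Real.rpow_add hn']
            congr 1
            ring
          simp only [Function.comp_apply, hr, e]
          ring
        have h3 := (Complex.continuous_exp.tendsto _).comp
          (((Complex.continuous_ofReal.tendsto _).comp h1).mul_const Complex.I)
        simpa [Function.comp_def] using h3
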